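/- **Theorem (convergence of the $N+1$-player game to the mean field game).** *Data.* Let $c:\{0,1\}\times[0,1]\times[0,\infty)\to[0,\infty)$, $c=c(i,\theta,\alpha)$, and $\psi:\{0,1\}\times[0,1]\to[0,\infty)$, $\psi=\psi(i,\theta)$, be Lipschitz in $\theta$ (for $c$: for each fixed $i,\alpha$). Suppose that $\alpha\mapsto c(i,\theta,\alpha)$ is superlinear, differentiable on $[0,\infty)$ and uniformly convex, with a convexity modulus $\gamma>0$ independent of $(i,\theta)$, and that $c'=\partial_\alpha c$ is Lipschitz in $\theta$, uniformly in $(i,\alpha)$. Put $$h(p,\theta,i)=\min_{\alpha\ge0}\,[c(i,\theta,\alpha)+\alpha p],\qquad \alpha^*(p,\theta,i)=\operatorname{argmin}_{\alpha\ge0}\,[c(i,\theta,\alpha)+\alpha p].$$ *Mean field game.* For $T>0$ and $\bar\theta\in[0,1]$, let $u(i,t)$, $i\in\{0,1\}$, and $\theta(t)\in[0,1]$ solve on $[0,T]$ $$-\tfrac{d}{dt}u(i,t)=h\big(u(1-i,t)-u(i,t),\theta(t),i\big),\qquad u(i,T)=\psi(i,\theta(T)),$$ $$\tfrac{d}{dt}\theta=(1-\theta)\,\alpha^*(u(0,t)-u(1,t),\theta,1)-\theta\,\alpha^*(u(1,t)-u(0,t),\theta,0),\qquad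 \theta(0)=\bar\theta .$$ *$N+1$-player game, $N\ge1$.* Let $u_n(i,t)$, $i\in\{0,1\}$, $0\le n\le N$, solve on $[0,T]$ $$-\tfrac{d}{dt}u_n(i,t)=\gamma^+(i,n,t)(u_{n+1}-u_n)(i,t)+\gamma^-(i,n,t)(u_{n-1}-u_n)(i,t)+h\big(u_n(1-i,t)-u_n(i,t),\tfrac nN,i\big),$$ with $u_n(i,T)=\psi(i,\tfrac nN)$, where $\beta(i,n,t)=\alpha^*\big(u_n(1-i,t)-u_n(i,t),\tfrac nN,i\big)$ is the equilibrium control and $$\gamma^+(i,n,t)=(N-n)\,\beta(1,n+1-i,t),\qquad \gamma^-(i,n,t)=n\,\beta(0,n-i,t)$$ (so $\gamma^+=0$ for $n=N$ and $\gamma^-=0$ for $n=0$). Let $(i(t),n(t))_{t\in[0,T]}$, the state of a reference player and the number of the other $N$ players in state $0$, be a continuous-time Markov process on $\{0,1\}\times\{0,\dots,N\}$ with transition rates $\beta(i,n,t)$ for $(i,n)\to(1-i,n)$, $\gamma^\pm(i,n,t)$ for $(i,n)\to(i,n\pm1)$, and $0$ for all other transitions; that is, for $y\ne x$, $\mathbb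 P(X_{t+h}=y\mid X_t=x)=h\cdot\text{rate}_t(x,y)+o(h)$ as $h\downarrow0$, uniformly in $t$, where $X=(i,n)$. Suppose that the initial states of the $N$ other players are independent and each equals $0$ with probability $\bar\theta$, so that $n(0)$ has the binomial law with parameters $N,\bar\theta$; the law of $i(0)$, and its dependence on $n(0)$, are arbitrary. Define $$V_N(t)=\mathbb E\Big[\big(\tfrac{n(t)}N-\theta(t)\big)^2\Big],\qquad Q_N(t)=\sum_{i\in\{0,1\}}\mathbb E\Big[\big(u(i,t)-u_{n(t)}(i,t)\big)^2\Big].$$ *Claim.* There are constants $C_1,C_2>0$, depending only on $c$ and $\psi$ (not on $T$, $N$, $\bar\theta$, the solutions or the process), such that with $C=\max\{C_1,C_2\}$ the following holds whenever $\rho=TC<1$: for all $\bar\theta\in[0,1]$, $N\ge1$, all solutions and processes as above and all $t\in[0,T]$, $$V_N(t)\le\int_0^tC_1\,(V_N+Q_N)(s)\,ds+\frac{C_1}N,\qquad Q_N(t)\le\int_t^TC_2\,(V_N+Q_N)(s)\,ds+\frac{C_2}N,$$ and $$Q_N(t)+V_N(t)\le\frac{C}{1-\rho}\,\frac1N .$$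 -/

import Mathlib

open Set Filter Topology MeasureTheory ProbabilityTheory

noncomputable section

namespace TwoStateGame

/-- The two states `0`, `1` of a player are the elements of `Fin 2`; the other state is `1 - i`.
A running cost `c i θ α` and a terminal cost `ψ i θ` matter only for `θ ∈ [0,1]` and `α ≥ 0`.
`c'`, the derivative in `α ∈ [0,∞)`, is one-sided at `α = 0`. The modulus of uniform convexity and
the Lipschitz constant of `c'` in `θ` do not depend on the other variables; the Lipschitz constant
of `c` in `θ` may depend on `α`. -/
structure CostAssumptions (c : Fin 2 → ℝ → ℝ → ℝ) (ψ : Fin 2 → ℝ → ℝ) : Prop where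
  c_nonneg : ∀ i, ∀ θ ∈ Icc (0 : ℝ) 1, ∀ α ∈ Ici (0 : ℝ), 0 ≤ c i θ α
  psi_nonneg : ∀ i, ∀ θ ∈ Icc (0 : ℝ) 1, 0 ≤ ψ i θ
  c_lipschitz : ∀ i, ∀ α ∈ Ici (0 : ℝ), ∃ L : ℝ, ∀ θ ∈ Icc (0 : ℝ) 1, ∀ θ' ∈ Icc (0 : ℝ) 1,
    |c i θ α - c i θ' α| ≤ L * |θ - θ'|
  psi_lipschitz : ∃ L : ℝ, ∀ i, ∀ θ ∈ Icc (0 : ℝ) 1, ∀ θ' ∈ Icc (0 : ℝ) 1,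
    |ψ i θ - ψ i θ'| ≤ L * |θ - θ'|
  c_uniformlyConvex : ∃ γ : ℝ, 0 < γ ∧ ∀ i, ∀ θ ∈ Icc (0 : ℝ) 1,
    StrongConvexOn (Ici (0 : ℝ)) γ (c i θ)
  c_superlinear : ∀ i, ∀ θ ∈ Icc (0 : ℝ) 1, Tendsto (fun α => c i θ α / α) atTop atTop
  c_differentiable : ∀ i, ∀ θ ∈ Icc (0 : ℝ) 1, DifferentiableOn ℝ (c i θ) (Ici 0)
  c_deriv_lipschitz : ∃ K : ℝ, ∀ i, ∀ α ∈ Ici (0 : ℝ), ∀ θ ∈ Icc (0 : ℝ) 1,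
    ∀ θ' ∈ Icc (0 : ℝ) 1,
      |derivWithin (c i θ) (Ici 0) α - derivWithin (c i θ') (Ici 0) α| ≤ K * |θ - θ'|

/-- `h(p, θ, i) = min_{α ≥ 0} [c(i, θ, α) + α p]`. -/
def hamiltonian (c : Fin 2 → ℝ → ℝ → ℝ) (p θ : ℝ) (i : Fin 2) : ℝ :=
  sInf ((fun α => c i θ α + α * p) '' Ici 0)

/-- `α*(p, θ, i) = argmin_{α ≥ 0} [c(i, θ, α) + α p]`: the minimizer, which exists and is unique
under the assumptions on `c`. -/
def optimalRate (c : Fin 2 → ℝ → ℝ → ℝ) (p θ : ℝ) (i : Fin 2) : ℝ :=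
  Classical.epsilon fun a : ℝ => 0 ≤ a ∧ IsMinOn (fun α => c i θ α + α * p) (Ici 0) a

/-- Transition rate of the number of the other players in state `0` from `n` to `n + 1`, when the
reference player is in state `i` and the other players use the control `β`. -/
def gammaPlus (N : ℕ) (β : Fin 2 → ℕ → ℝ → ℝ) (i : Fin 2) (n : ℕ) (t : ℝ) : ℝ :=
  ((N : ℝ) - n) * β 1 (n + 1 - (i : ℕ)) t

/-- The transition rate from `n` to `n - 1`. -/
def gammaMinus (β : Fin 2 → ℕ → ℝ → ℝ) (i : Fin 2) (n : ℕ) (t : ℝ) : ℝ :=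
  (n : ℝ) * β 0 (n - (i : ℕ)) t

/-- The control `β(i,n,t) = α*(u_n(1-i,t) - u_n(i,t), n/N, i)` given by the function `u i n t`. -/
def feedbackControl (c : Fin 2 → ℝ → ℝ → ℝ) (N : ℕ) (u : Fin 2 → ℕ → ℝ → ℝ)
    (i : Fin 2) (n : ℕ) (t : ℝ) : ℝ :=
  optimalRate c (u (1 - i) n t - u i n t) ((n : ℝ) / N) i

/-- `u i n t` (`i` a state, `0 ≤ n ≤ N`, `t ∈ [0,T]`) solves the Hamilton-Jacobi system of the
`N + 1` player game in Nash equilibrium, with its terminal condition. The values of `u` at indices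
outside `0, …, N` only occur multiplied by `0`. -/
structure IsNPlayerSolution (c : Fin 2 → ℝ → ℝ → ℝ) (ψ : Fin 2 → ℝ → ℝ) (T : ℝ) (N : ℕ)
    (u : Fin 2 → ℕ → ℝ → ℝ) : Prop where
  hj : ∀ i, ∀ n ≤ N, ∀ t ∈ Icc 0 T,
    HasDerivWithinAt (u i n)
      (-(gammaPlus N (feedbackControl c N u) i n t * (u i (n + 1) t - u i n t)
        + gammaMinus (feedbackControl c N u) i n t * (u i (n - 1) t - u i n t)
        + hamiltonian c (u (1 - i) n t - u i n t) ((n : ℝ) / N) i))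
      (Icc 0 T) t
  terminal : ∀ i, ∀ n ≤ N, u i n T = ψ i ((n : ℝ) / N)

/-- `(u, θ)` solves the mean field system on `[0,T]`, with its initial-terminal conditions. -/
structure IsMeanFieldSolution (c : Fin 2 → ℝ → ℝ → ℝ) (ψ : Fin 2 → ℝ → ℝ) (T θbar : ℝ)
    (u : Fin 2 → ℝ → ℝ) (θ : ℝ → ℝ) : Prop where
  mem : ∀ t ∈ Icc 0 T, θ t ∈ Icc (0 : ℝ) 1
  hj : ∀ i, ∀ t ∈ Icc 0 T,
    HasDerivWithinAt (u i) (-hamiltonian c (u (1 - i) t - u i t) (θ t) i) (Icc 0 T) t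
  kolmogorov : ∀ t ∈ Icc 0 T,
    HasDerivWithinAt θ
      ((1 - θ t) * optimalRate c (u 0 t - u 1 t) (θ t) 1
        - θ t * optimalRate c (u 1 t - u 0 t) (θ t) 0)
      (Icc 0 T) t
  terminal : ∀ i, u i T = ψ i (θ T)
  initial : θ 0 = θbar

/-- Transition rates of the chain `(i(t), n(t))` when all the players use the control `β`. -/
def jumpRate (N : ℕ) (β : Fin 2 → ℕ → ℝ → ℝ) (x y : Fin 2 × Fin (N + 1)) (t : ℝ) : ℝ :=
  if y.1 = 1 - x.1 ∧ y.2 = x.2 then β x.1 x.2 t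
  else if y.1 = x.1 ∧ (y.2 : ℕ) = x.2 + 1 then gammaPlus N β x.1 x.2 t
  else if y.1 = x.1 ∧ (y.2 : ℕ) + 1 = x.2 then gammaMinus β x.1 x.2 t
  else 0

/-- `X t = (i(t), n(t))`, `t ∈ [0,T]`, is a Markov process with values in `{0,1} × {0,…,N}` whose
transition rates are those of the game in which all the players use the control `β`:
`P(X(t+h) = y | X(t) = x) = h * jumpRate N β x y t + o(h)` for `y ≠ x`, with `o(h)` uniform in
`t`, as it is for rates that are continuous on `[0,T]`. -/
structure IsGameProcess {Ω : Type*} [MeasurableSpace Ω] (μ : Measure Ω) (T : ℝ) (N : ℕ)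
    (β : Fin 2 → ℕ → ℝ → ℝ) (X : ℝ → Ω → Fin 2 × Fin (N + 1)) : Prop where
  measurable : ∀ t ∈ Icc 0 T, Measurable (X t)
  /-- Given the present, the future is independent of the past. -/
  markov : ∀ s t, 0 ≤ s → s ≤ t → t ≤ T → ∀ A : Set Ω,
    MeasurableSet[⨆ r ∈ Icc 0 s, MeasurableSpace.comap (X r) inferInstance] A → ∀ x y,
      μ (A ∩ {ω | X s ω = x}) ≠ 0 →
        μ[|A ∩ {ω | X s ω = x}] {ω | X t ω = y} = μ[|{ω | X s ω = x}] {ω | X t ω = y}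
  rate : ∀ ε > 0, ∃ δ > 0, ∀ t h : ℝ, 0 ≤ t → 0 < h → h < δ → t + h ≤ T → ∀ x y, y ≠ x →
    μ {ω | X t ω = x} ≠ 0 →
      |(μ[|{ω | X t ω = x}]).real {ω | X (t + h) ω = y} - h * jumpRate N β x y t| ≤ ε * h

/-- `n` is distributed as the number of successes in `N` independent Bernoulli(`p`) trials. -/
def IsBinomial {Ω : Type*} [MeasurableSpace Ω] (μ : Measure Ω) (N : ℕ) (p : ℝ)
    (n : Ω → Fin (N + 1)) : Prop :=
  ∀ k : Fin (N + 1),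
    μ.real {ω | n ω = k} = (N.choose k : ℝ) * p ^ (k : ℕ) * (1 - p) ^ (N - (k : ℕ))

/-- `V_N(t) = E[(n(t)/N - θ(t))²]`. -/
def VN {Ω : Type*} [MeasurableSpace Ω] (μ : Measure Ω) (N : ℕ)
    (X : ℝ → Ω → Fin 2 × Fin (N + 1)) (θ : ℝ → ℝ) (t : ℝ) : ℝ :=
  ∫ ω, (((X t ω).2 : ℕ) / (N : ℝ) - θ t) ^ 2 ∂μ

/-- `E[(u(i,t) - u_{n(t)}(i,t))²]`: this is `W_N(t)` for `i = 0` and its barred version for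
`i = 1`. -/
def WN {Ω : Type*} [MeasurableSpace Ω] (μ : Measure Ω) (N : ℕ)
    (X : ℝ → Ω → Fin 2 × Fin (N + 1)) (u : Fin 2 → ℝ → ℝ) (uN : Fin 2 → ℕ → ℝ → ℝ)
    (i : Fin 2) (t : ℝ) : ℝ :=
  ∫ ω, (u i t - uN i ((X t ω).2 : ℕ) t) ^ 2 ∂μ

/-- `Q_N(t)`, the sum of the mean-square distances of the values in the two states. -/
def QN {Ω : Type*} [MeasurableSpace Ω] (μ : Measure Ω) (N : ℕ)
    (X : ℝ → Ω → Fin 2 × Fin (N + 1)) (u : Fin 2 → ℝ → ℝ) (uN : Fin 2 → ℕ → ℝ → ℝ)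
    (t : ℝ) : ℝ :=
  WN μ N X u uN 0 t + WN μ N X u uN 1 t

end TwoStateGame

end

/-! The constants may be taken as large as the data require, so only horizons that are short
relative to the data matter. On these, `VN_add_QN_le` bounds `VN + QN` by `(3 + 4 * K ^ 2) / N`, and
every claimed inequality then follows by nonnegativity.

Three ingredients carry that bound. Regularity of the data: strong convexity and the Lipschitz bound
on `c'` make `optimalRate` Lipschitz in momentum and measure, and the Hamiltonian Lipschitz for
bounded momenta (`exists_dataBounds`). A minimum principle confines both value functions to `[0,
P]`, which bounds the momenta. Gradient estimate: for short times `u_n` varies by `O(1/N)` between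
neighbouring `n` (`nPlayer_gradient`). Hence the aggregate jump rates, of size `N`, change only by
`O(1)` when the reference player changes state, and a jump moves the values by `O(1/N)`. Dynkin's
formula for `(n/N - θ)²` and `(u - u_n)²`: the drifts of the game and of the mean field agree up to
Lipschitz errors and `O(1/N)`, and the quadratic jump terms are `N · O(1/N²)`. The generator is
therefore at most a constant times `gap + 1/N` (`abs_generator_state_le`, `abs_generator_value_le`).

Forward in time, `VN` starts from a binomial variance; backward in time, `QN` starts from a multiple
of `VN` at `T`. Bounding the integrands by the maximum of `VN + QN` and absorbing that maximum for
short `T` closes the estimate. -/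

namespace TwoStateGame

/-! ### Regularity of the optimal rate and of the Hamiltonian -/

/-- A minimizer of `α ↦ c i θ α + α p` over `α ≥ 0` exists, and `optimalRate` picks one. -/
theorem optimalRate_spec {c : Fin 2 → ℝ → ℝ → ℝ} {ψ : Fin 2 → ℝ → ℝ} (hc : CostAssumptions c ψ)
    (p : ℝ) {θ : ℝ} (hθ : θ ∈ Icc (0 : ℝ) 1) (i : Fin 2) :
    0 ≤ optimalRate c p θ i ∧
      IsMinOn (fun α => c i θ α + α * p) (Ici 0) (optimalRate c p θ i) := by
  unfold optimalRate
  apply Classical.epsilon_spec (p := fun a : ℝ => 0 ≤ a ∧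
    IsMinOn (fun α => c i θ α + α * p) (Ici 0) a)
  have hcont : ContinuousOn (fun α => c i θ α + α * p) (Ici 0) :=
    (hc.c_differentiable i θ hθ).continuousOn.add (by fun_prop)
  -- With `c/α ≥ |c(0)| - p`, the objective at `α ≥ 1` is at least `|c(0)| α ≥ c(0)`, its value at
  -- zero up to sign.
  obtain ⟨R, hR⟩ := eventually_atTop.1
    ((hc.c_superlinear i θ hθ).eventually_ge_atTop (|c i θ 0| - p))
  have hev : ∀ α, max R 1 ≤ α → c i θ 0 + 0 * p ≤ c i θ α + α * p := by
    intro α hα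
    have h1 : 1 ≤ α := le_trans (le_max_right _ _) hα
    have h2 := hR α (le_trans (le_max_left _ _) hα)
    rw [le_div_iff₀ (by linarith)] at h2
    nlinarith [le_abs_self (c i θ 0), abs_nonneg (c i θ 0)]
  obtain ⟨a, ha, hmin⟩ := hcont.exists_isMinOn' isClosed_Ici (x₀ := 0) (by simp) (by
    rw [Filter.eventually_inf_principal, Filter.eventually_iff, mem_cocompact]
    refine ⟨Icc 0 (max R 1), isCompact_Icc, ?_⟩
    intro α hα h0
    apply hev
    simp only [mem_compl_iff, mem_Icc, not_and, not_le] at hα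
    exact (hα h0).le)
  exact ⟨a, ha, hmin⟩

theorem hamiltonian_eq {c : Fin 2 → ℝ → ℝ → ℝ} {ψ : Fin 2 → ℝ → ℝ} (hc : CostAssumptions c ψ)
    (p : ℝ) {θ : ℝ} (hθ : θ ∈ Icc (0 : ℝ) 1) (i : Fin 2) :
    hamiltonian c p θ i = c i θ (optimalRate c p θ i) + optimalRate c p θ i * p := by
  obtain ⟨h0, hmin⟩ := optimalRate_spec hc p hθ i
  refine IsLeast.csInf_eq ⟨⟨_, h0, rfl⟩, ?_⟩
  rintro _ ⟨α, hα, rfl⟩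
  exact hmin hα

theorem hamiltonian_le {c : Fin 2 → ℝ → ℝ → ℝ} {ψ : Fin 2 → ℝ → ℝ} (hc : CostAssumptions c ψ)
    (p : ℝ) {θ : ℝ} (hθ : θ ∈ Icc (0 : ℝ) 1) (i : Fin 2) {α : ℝ} (hα : 0 ≤ α) :
    hamiltonian c p θ i ≤ c i θ α + α * p := by
  rw [hamiltonian_eq hc p hθ i]
  exact (optimalRate_spec hc p hθ i).2 hα

/-- The increments of `c i θ - c i θ'` in `α` are controlled by the Lipschitz constant of `c'`. -/
theorem exists_cost_increment_bound {c : Fin 2 → ℝ → ℝ → ℝ} {ψ : Fin 2 → ℝ → ℝ}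
    (hc : CostAssumptions c ψ) :
    ∃ K : ℝ, 0 ≤ K ∧ ∀ i, ∀ θ ∈ Icc (0 : ℝ) 1, ∀ θ' ∈ Icc (0 : ℝ) 1, ∀ α β : ℝ, 0 ≤ α → 0 ≤ β →
      |(c i θ β - c i θ' β) - (c i θ α - c i θ' α)| ≤ K * |θ - θ'| * |β - α| := by
  obtain ⟨K, hK⟩ := hc.c_deriv_lipschitz
  refine ⟨|K|, abs_nonneg K, fun i θ hθ θ' hθ' α β hα hβ => ?_⟩
  refine (convex_Ici (0 : ℝ)).norm_image_sub_le_of_norm_hasDerivWithin_le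
    (f := fun x => c i θ x - c i θ' x)
    (f' := fun x => derivWithin (c i θ) (Ici 0) x - derivWithin (c i θ') (Ici 0) x)
    (fun x hx => ?_) (fun x hx => ?_) hα hβ
  · exact ((hc.c_differentiable i θ hθ x hx).hasDerivWithinAt).sub
      ((hc.c_differentiable i θ' hθ' x hx).hasDerivWithinAt)
  · exact (hK i x hx θ hθ θ' hθ').trans (by gcongr; exact le_abs_self K)

/-- Growth of the cost away from the minimizer, from strong convexity. -/
theorem cost_growth {c : Fin 2 → ℝ → ℝ → ℝ} {ψ : Fin 2 → ℝ → ℝ} (hc : CostAssumptions c ψ)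
    {γ p θ : ℝ} {i : Fin 2} (hθ : θ ∈ Icc (0 : ℝ) 1) (hγ : StrongConvexOn (Ici (0 : ℝ)) γ (c i θ))
    {b : ℝ} (hb : 0 ≤ b) :
    c i θ (optimalRate c p θ i) + optimalRate c p θ i * p
      + γ / 4 * (b - optimalRate c p θ i) ^ 2 ≤ c i θ b + b * p := by
  obtain ⟨h0, hmin⟩ := optimalRate_spec hc p hθ i
  set a := optimalRate c p θ i
  obtain ⟨-, hs⟩ := hγ
  -- Testing minimality at the midpoint of `a` and `b` gives the modulus `γ/4`.
  have h1 := hs (mem_Ici.2 h0) (mem_Ici.2 hb) (show (0 : ℝ) ≤ 1 / 2 by norm_num)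
    (show (0 : ℝ) ≤ 1 / 2 by norm_num) (by norm_num)
  have h2 : c i θ a + a * p ≤ c i θ ((1 / 2 : ℝ) • a + (1 / 2 : ℝ) • b)
      + ((1 / 2 : ℝ) • a + (1 / 2 : ℝ) • b) * p := by
    apply hmin
    simp only [smul_eq_mul, mem_Ici]
    linarith
  simp only [smul_eq_mul, Real.norm_eq_abs, sq_abs] at h1 h2
  nlinarith

/-- Each minimizer competes in the other's problem. Adding the two growth inequalities leaves
`(γ/2)|b - a|²` against an increment of `c i θ - c i θ'` and `(p - q)(b - a)`, both linear in `|b -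
a|`, which is then divided out. -/
theorem exists_optimalRate_lipschitz {c : Fin 2 → ℝ → ℝ → ℝ} {ψ : Fin 2 → ℝ → ℝ}
    (hc : CostAssumptions c ψ) :
    ∃ L : ℝ, 0 ≤ L ∧ ∀ i p q, ∀ θ ∈ Icc (0 : ℝ) 1, ∀ θ' ∈ Icc (0 : ℝ) 1,
      |optimalRate c p θ i - optimalRate c q θ' i| ≤ L * (|p - q| + |θ - θ'|) := by
  obtain ⟨γ, hγ, hconv⟩ := hc.c_uniformlyConvex
  obtain ⟨K, hK, hinc⟩ := exists_cost_increment_bound hc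
  refine ⟨2 / γ * (1 + K), by positivity, fun i p q θ hθ θ' hθ' => ?_⟩
  have ha := (optimalRate_spec hc p hθ i).1
  have hb := (optimalRate_spec hc q hθ' i).1
  have h1 := cost_growth hc (p := p) hθ (hconv i θ hθ) hb
  have h2 := cost_growth hc (p := q) hθ' (hconv i θ' hθ') ha
  have h3 := hinc i θ hθ θ' hθ' _ _ ha hb
  set a := optimalRate c p θ i
  set b := optimalRate c q θ' i
  have h4 : γ / 2 * |b - a| ^ 2 ≤ (|p - q| + K * |θ - θ'|) * |b - a| := by
    rw [sq_abs]
    have h5 : (p - q) * (b - a) ≤ |p - q| * |b - a| := by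
      rw [← abs_mul]; exact le_abs_self _
    have h6 := le_abs_self ((c i θ b - c i θ' b) - (c i θ a - c i θ' a))
    nlinarith
  have h5 : γ / 2 * |b - a| ≤ |p - q| + K * |θ - θ'| := by
    rcases (abs_nonneg (b - a)).eq_or_lt with h | h
    · rw [← h]; simp only [mul_zero]; positivity
    · refine le_of_mul_le_mul_right ?_ h
      linarith
  have h6 : |p - q| + K * |θ - θ'| ≤ (1 + K) * (|p - q| + |θ - θ'|) := by
    nlinarith [abs_nonneg (p - q), abs_nonneg (θ - θ'), mul_nonneg hK (abs_nonneg (p - q))]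
  rw [abs_sub_comm a b]
  calc |b - a| = 2 / γ * (γ / 2 * |b - a|) := by field_simp
    _ ≤ 2 / γ * ((1 + K) * (|p - q| + |θ - θ'|)) := 
        mul_le_mul_of_nonneg_left (h5.trans h6) (by positivity)
    _ = _ := by ring

/-- Uniform bounds on the data, valid for momenta bounded by `P`. -/
structure DataBounds (c : Fin 2 → ℝ → ℝ → ℝ) (ψ : Fin 2 → ℝ → ℝ) (P K : ℝ) : Prop where
  one_le : 1 ≤ K
  bound_nonneg : 0 ≤ P
  psi_mem : ∀ i, ∀ θ ∈ Icc (0 : ℝ) 1, ψ i θ ∈ Icc 0 (P / 2)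
  ham_le : ∀ i p, ∀ θ ∈ Icc (0 : ℝ) 1, hamiltonian c p θ i ≤ P / 2
  ham_ge : ∀ i p, ∀ θ ∈ Icc (0 : ℝ) 1, optimalRate c p θ i * p ≤ hamiltonian c p θ i
  rate_nonneg : ∀ i p, ∀ θ ∈ Icc (0 : ℝ) 1, 0 ≤ optimalRate c p θ i
  rate_le : ∀ i p, |p| ≤ P → ∀ θ ∈ Icc (0 : ℝ) 1, optimalRate c p θ i ≤ K
  psi_lip : ∀ i, ∀ θ ∈ Icc (0 : ℝ) 1, ∀ θ' ∈ Icc (0 : ℝ) 1, |ψ i θ - ψ i θ'| ≤ K * |θ - θ'|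
  rate_lip : ∀ i p q, ∀ θ ∈ Icc (0 : ℝ) 1, ∀ θ' ∈ Icc (0 : ℝ) 1,
    |optimalRate c p θ i - optimalRate c q θ' i| ≤ K * (|p - q| + |θ - θ'|)
  ham_lip : ∀ i p q, |p| ≤ P → |q| ≤ P → ∀ θ ∈ Icc (0 : ℝ) 1, ∀ θ' ∈ Icc (0 : ℝ) 1,
    |hamiltonian c p θ i - hamiltonian c q θ' i| ≤ K * (|p - q| + |θ - θ'|)

theorem abs_sub_le_one_of_mem_unit {θ θ' : ℝ} (hθ : θ ∈ Icc (0 : ℝ) 1)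
    (hθ' : θ' ∈ Icc (0 : ℝ) 1) : |θ - θ'| ≤ 1 := by
  rw [abs_le]
  constructor <;> linarith [hθ.1, hθ.2, hθ'.1, hθ'.2]

theorem exists_dataBounds {c : Fin 2 → ℝ → ℝ → ℝ} {ψ : Fin 2 → ℝ → ℝ}
    (hc : CostAssumptions c ψ) : ∃ P K : ℝ, DataBounds c ψ P K := by
  obtain ⟨L, hL0, hL⟩ := exists_optimalRate_lipschitz hc
  obtain ⟨K, hK0, hK⟩ := exists_cost_increment_bound hc
  obtain ⟨Lψ, hLψ⟩ := hc.psi_lipschitz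
  -- The Lipschitz constant of `c` in `θ` may depend on `α`; it is used only at `α = 0`, and the
  -- increment bound carries it to the bounded range of optimal rates.
  choose L₀ hL₀ using fun i => hc.c_lipschitz i 0 (by simp)
  have zero_mem : (0 : ℝ) ∈ Icc (0 : ℝ) 1 := by simp
  set S : ℝ := |L₀ 0| + |L₀ 1| with hS
  have hLS : ∀ i, L₀ i ≤ S := by
    intro i
    fin_cases i
    · exact (le_abs_self _).trans (le_add_of_nonneg_right (abs_nonneg _))
    · exact (le_abs_self _).trans (le_add_of_nonneg_left (abs_nonneg _))
  have hS0 : 0 ≤ S := by positivity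
  have hc0 : ∀ i, ∀ θ ∈ Icc (0 : ℝ) 1, ∀ θ' ∈ Icc (0 : ℝ) 1,
      |c i θ 0 - c i θ' 0| ≤ S * |θ - θ'| := fun i θ hθ θ' hθ' =>
    (hL₀ i θ hθ θ' hθ').trans (by gcongr; exact hLS i)
  set M : ℝ := |c 0 0 0| + |c 1 0 0| + S with hM
  have hM0 : 0 ≤ M := by positivity
  have hcM : ∀ i, ∀ θ ∈ Icc (0 : ℝ) 1, c i θ 0 ≤ M := by
    intro i θ hθ
    have h1 := (le_abs_self _).trans (hc0 i θ hθ 0 zero_mem)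
    have h2 := mul_le_mul_of_nonneg_left (abs_sub_le_one_of_mem_unit hθ zero_mem) hS0
    have h3 : c i 0 0 ≤ |c 0 0 0| + |c 1 0 0| := by
      fin_cases i
      · exact (le_abs_self _).trans (le_add_of_nonneg_right (abs_nonneg _))
      · exact (le_abs_self _).trans (le_add_of_nonneg_left (abs_nonneg _))
    linarith
  set Mψ : ℝ := |ψ 0 0| + |ψ 1 0| + |Lψ| with hMψ
  have hψM : ∀ i, ∀ θ ∈ Icc (0 : ℝ) 1, ψ i θ ≤ Mψ := by
    intro i θ hθ
    have h1 := (le_abs_self _).trans (hLψ i θ hθ 0 zero_mem)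
    have h2 := mul_le_mul (le_abs_self Lψ) (abs_sub_le_one_of_mem_unit hθ zero_mem)
      (abs_nonneg _) (abs_nonneg _)
    have h3 : ψ i 0 ≤ |ψ 0 0| + |ψ 1 0| := by
      fin_cases i
      · exact (le_abs_self _).trans (le_add_of_nonneg_right (abs_nonneg _))
      · exact (le_abs_self _).trans (le_add_of_nonneg_left (abs_nonneg _))
    linarith
  -- `P / 2` dominates both `ψ` and the Hamiltonian (competitor `α = 0`), so over a horizon at most
  -- 1 the values stay below `P`.
  set P : ℝ := 2 * (Mψ + M) with hP
  have hP0 : 0 ≤ P := by positivity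
  set A : ℝ := optimalRate c 0 0 0 + optimalRate c 0 0 1 + L * (P + 1) with hA
  have hrate0 : ∀ i, 0 ≤ optimalRate c 0 0 i := fun i => (optimalRate_spec hc 0 zero_mem i).1
  have hA0 : 0 ≤ A := by have := hrate0 0; have := hrate0 1; positivity
  have hAle : ∀ i p, |p| ≤ P → ∀ θ ∈ Icc (0 : ℝ) 1, optimalRate c p θ i ≤ A := by
    intro i p hp θ hθ
    have h1 := (le_abs_self _).trans (hL i p 0 θ hθ 0 zero_mem)
    have h2 : L * (|p - 0| + |θ - 0|) ≤ L * (P + 1) := by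
      gcongr
      · simpa using hp
      · exact abs_sub_le_one_of_mem_unit hθ zero_mem
    have h3 : optimalRate c 0 0 i ≤ optimalRate c 0 0 0 + optimalRate c 0 0 1 := by
      fin_cases i
      · exact le_add_of_nonneg_right (hrate0 1)
      · exact le_add_of_nonneg_left (hrate0 0)
    linarith
  -- The minimizer for `(q, θ')` is a competitor for `(p, θ)`; the other sign follows by exchanging
  -- the roles.
  have hham : ∀ i p q, |p| ≤ P → |q| ≤ P → ∀ θ ∈ Icc (0 : ℝ) 1, ∀ θ' ∈ Icc (0 : ℝ) 1,
      hamiltonian c p θ i - hamiltonian c q θ' i ≤ (S + K * A + A) * (|p - q| + |θ - θ'|) := by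
    intro i p q hp hq θ hθ θ' hθ'
    have hb := (optimalRate_spec hc q hθ' i).1
    have h1 := hamiltonian_le hc p hθ i hb
    rw [hamiltonian_eq hc q hθ' i]
    have hbA := hAle i q hq θ' hθ'
    have h2 := hK i θ hθ θ' hθ' 0 _ le_rfl hb
    set b := optimalRate c q θ' i
    rw [sub_zero, abs_of_nonneg hb] at h2
    have h2' := (abs_le.1 h2).2
    have h3 := (abs_le.1 (hc0 i θ hθ θ' hθ')).2
    have h4 : K * |θ - θ'| * b ≤ K * |θ - θ'| * A := by gcongr
    have h5 : b * (p - q) ≤ A * |p - q| :=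
      (mul_le_mul_of_nonneg_left (le_abs_self _) hb).trans (by gcongr)
    have h6 : 0 ≤ (S + K * A) * |p - q| := by positivity
    have h7 : 0 ≤ A * |θ - θ'| := by positivity
    nlinarith
  refine ⟨P, 1 + A + |Lψ| + L + (S + K * A + A), ?_⟩
  have hKA : 0 ≤ K * A := by positivity
  have hLψ0 := abs_nonneg Lψ
  have hMψ0 : 0 ≤ Mψ := by positivity
  refine ⟨by linarith, hP0, fun i θ hθ => ⟨hc.psi_nonneg i θ hθ, (hψM i θ hθ).trans (by linarith)⟩,
    ?_, ?_, fun i p θ hθ => (optimalRate_spec hc p hθ i).1,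
    fun i p hp θ hθ => (hAle i p hp θ hθ).trans (by linarith), ?_, ?_, ?_⟩
  · intro i p θ hθ
    have h1 := hamiltonian_le hc p hθ i le_rfl
    have h2 := hcM i θ hθ
    linarith
  · intro i p θ hθ
    rw [hamiltonian_eq hc p hθ i]
    have := hc.c_nonneg i θ hθ _ (optimalRate_spec hc p hθ i).1
    linarith
  · intro i θ hθ θ' hθ'
    refine (hLψ i θ hθ θ' hθ').trans ?_
    gcongr
    linarith [le_abs_self Lψ]
  · intro i p q θ hθ θ' hθ'
    refine (hL i p q θ hθ θ' hθ').trans ?_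
    gcongr
    linarith
  · intro i p q hp hq θ hθ θ' hθ'
    have hle : (S + K * A + A) * (|p - q| + |θ - θ'|) ≤
        (1 + A + |Lψ| + L + (S + K * A + A)) * (|p - q| + |θ - θ'|) :=
      mul_le_mul_of_nonneg_right (by linarith) (by positivity)
    refine (abs_le.2 ⟨?_, ?_⟩).trans hle
    · have := hham i q p hq hp θ' hθ' θ hθ
      rw [abs_sub_comm q p, abs_sub_comm θ' θ] at this
      linarith
    · exact hham i p q hp hq θ hθ θ' hθ'

/-! ### Backward barrier and minimum principles -/

theorem hasDerivWithinAt_Ici_of_Icc {f : ℝ → ℝ} {d a T t : ℝ}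
    (h : HasDerivWithinAt f d (Icc a T) t) (ht : t ∈ Ico a T) : HasDerivWithinAt f d (Ici t) t :=
  (h.mono (Icc_subset_Icc_left ht.1)).mono_of_mem_nhdsWithin (Icc_mem_nhdsGE ht.2)

/-- Backward barrier principle: a finite family which is positive at time `T` and whose members
strictly decrease whenever they first touch zero is positive on `[0,T]`. -/
theorem pos_of_backward_barrier {ι : Type*} [Finite ι] {T : ℝ} {v v' : ι → ℝ → ℝ}
    (hd : ∀ x, ∀ t ∈ Icc 0 T, HasDerivWithinAt (v x) (v' x t) (Icc 0 T) t)
    (hT : ∀ x, 0 < v x T)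
    (hneg : ∀ t ∈ Icc 0 T, ∀ x, v x t = 0 → (∀ y, 0 ≤ v y t) → v' x t < 0) :
    ∀ x, ∀ t ∈ Icc 0 T, 0 < v x t := by
  by_contra! hcon
  obtain ⟨x₁, t₁, ht₁, hx₁⟩ := hcon
  have hcont : ∀ x, ContinuousOn (v x) (Icc 0 T) := fun x t ht => (hd x t ht).continuousWithinAt
  -- The greatest element of `S` is the last time at which some member is nonpositive. All members
  -- are positive afterwards, so the one vanishing there has a nonnegative right derivative.
  set S : Set ℝ := ⋃ x, {t ∈ Icc 0 T | v x t ≤ 0} with hS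
  have hSclosed : IsClosed S := isClosed_iUnion_of_finite fun x =>
    (hcont x).preimage_isClosed_of_isClosed isClosed_Icc isClosed_Iic
  have hSsub : S ⊆ Icc 0 T := iUnion_subset fun x t ht => ht.1
  have hScomp : IsCompact S := isCompact_Icc.of_isClosed_subset hSclosed hSsub
  obtain ⟨t₀, ht₀, hmax⟩ := hScomp.exists_isGreatest ⟨t₁, mem_iUnion.2 ⟨x₁, ht₁, hx₁⟩⟩
  obtain ⟨x₀, htI, hx₀⟩ := mem_iUnion.1 ht₀
  have hlt : t₀ < T := lt_of_le_of_ne htI.2 fun h => by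
    rw [h] at hx₀
    exact absurd (hT x₀) (not_lt.2 hx₀)
  have hpos : ∀ y, ∀ s ∈ Ioc t₀ T, 0 < v y s := by
    intro y s hs
    by_contra! h
    exact absurd (hmax (mem_iUnion.2 ⟨y, ⟨htI.1.trans hs.1.le, hs.2⟩, h⟩)) (not_le.2 hs.1)
  have hev : ∀ y, ∀ᶠ s in 𝓝[>] t₀, 0 < v y s := fun y => by
    filter_upwards [Ioc_mem_nhdsGT hlt] with s hs using hpos y s hs
  have hnn : ∀ y, 0 ≤ v y t₀ := by
    intro y
    have h1 : Tendsto (v y) (𝓝[>] t₀) (𝓝 (v y t₀)) :=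
      ((hasDerivWithinAt_Ici_of_Icc (hd y t₀ htI) ⟨htI.1, hlt⟩).continuousWithinAt).mono_left
        (nhdsWithin_mono _ Ioi_subset_Ici_self)
    exact ge_of_tendsto h1 ((hev y).mono fun _ h => h.le)
  have hzero : v x₀ t₀ = 0 := le_antisymm hx₀ (hnn x₀)
  have hderiv := hasDerivWithinAt_Ici_of_Icc (hd x₀ t₀ htI) ⟨htI.1, hlt⟩
  have hslope := (hasDerivWithinAt_iff_tendsto_slope' (by simp)).1
    (hderiv.mono (Ioi_subset_Ici_self))
  have hge : 0 ≤ v' x₀ t₀ := by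
    refine ge_of_tendsto hslope ?_
    filter_upwards [hev x₀, self_mem_nhdsWithin] with s hs hst
    rw [slope_def_field, hzero, sub_zero]
    exact div_nonneg hs.le (sub_nonneg.2 (le_of_lt hst))
  exact absurd (hneg t₀ htI x₀ hzero hnn) (not_lt.2 hge)

/-- Backward minimum principle for a finite family of functions. -/
theorem le_of_backward_min {ι : Type*} [Finite ι] {T m R : ℝ} {w w' : ι → ℝ → ℝ}
    (hd : ∀ x, ∀ t ∈ Icc 0 T, HasDerivWithinAt (w x) (w' x t) (Icc 0 T) t)
    (hT : ∀ x, m ≤ w x T)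
    (h : ∀ t ∈ Icc 0 T, ∀ x, (∀ y, w x t ≤ w y t) → w' x t ≤ R) :
    ∀ x, ∀ t ∈ Icc 0 T, m - R * (T - t) ≤ w x t := by
  intro x t ht
  -- The two `ε` make the slope and the terminal inequality strict. The barrier is common to all
  -- indices, so a member touching zero first is a minimizer of `w`.
  have key : ∀ ε > 0, 0 < w x t - m + (R + ε) * (T - t) + ε := by
    intro ε hε
    refine pos_of_backward_barrier (v := fun x t => w x t - m + (R + ε) * (T - t) + ε)
      (v' := fun x t => w' x t + (R + ε) * (-1)) ?_ ?_ ?_ x t ht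
    · intro y s hs
      exact (((hd y s hs).sub_const m).add
        (((hasDerivWithinAt_id s _).const_sub T).const_mul (R + ε))).add_const ε
    · intro y
      have := hT y
      simp only [sub_self, mul_zero]
      linarith
    · intro s hs y h0 hy
      have := h s hs y fun z => by have := hy z; linarith
      linarith
  refine le_of_forall_pos_le_add fun δ hδ => ?_
  have hpos : 0 < T - t + 1 := by linarith [ht.2]
  have h1 := key (δ / (T - t + 1)) (by positivity)
  have h2 : δ / (T - t + 1) * (T - t + 1) = δ := by field_simp
  linarith

theorem natCast_div_mem_unit {n N : ℕ} (hn : n ≤ N) : (n : ℝ) / N ∈ Icc (0 : ℝ) 1 :=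
  ⟨by positivity, div_le_one_of_le₀ (by exact_mod_cast hn) (by positivity)⟩

/-! ### Bounds and increments of the aggregate jump rates -/

section Gamma

variable {N n : ℕ} {K D t : ℝ} {β : Fin 2 → ℕ → ℝ → ℝ}

theorem gammaPlus_mem (hβ : ∀ i, ∀ m ≤ N, β i m t ∈ Icc 0 K) (i : Fin 2) (hn : n ≤ N) :
    gammaPlus N β i n t ∈ Icc 0 (N * K) := by
  unfold gammaPlus
  -- For `n = N` and `i = 0` the control is evaluated at `N + 1`, out of range, but its factor is
  -- zero.
  rcases hn.eq_or_lt with rfl | h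
  · obtain ⟨h1, h2⟩ := hβ i n le_rfl
    have : 0 ≤ K := h1.trans h2
    rw [sub_self, zero_mul]
    exact ⟨le_rfl, by positivity⟩
  · obtain ⟨h1, h2⟩ := hβ 1 (n + 1 - i) (by omega)
    have hn' : (0 : ℝ) ≤ (N : ℝ) - n := sub_nonneg.2 (by exact_mod_cast hn)
    exact ⟨mul_nonneg hn' h1, mul_le_mul (by linarith [n.cast_nonneg (α := ℝ)]) h2 h1
      (by positivity)⟩

theorem gammaMinus_mem (hβ : ∀ i, ∀ m ≤ N, β i m t ∈ Icc 0 K) (i : Fin 2) (hn : n ≤ N) :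
    gammaMinus β i n t ∈ Icc 0 (N * K) := by
  obtain ⟨h1, h2⟩ := hβ 0 (n - i) (by omega)
  exact ⟨mul_nonneg (by positivity) h1, mul_le_mul (by exact_mod_cast hn) h2 h1 (by positivity)⟩

theorem abs_mul_add_le {a b x y z : ℝ} (ha : |a| ≤ x) (hb : |b| ≤ y) (hc : |z| ≤ K) :
    |a * b + z| ≤ x * y + K := by
  refine (abs_add_le _ _).trans (add_le_add ?_ hc)
  rw [abs_mul]
  exact mul_le_mul ha hb (abs_nonneg _) ((abs_nonneg _).trans ha)

/-- Discrete product rule: the control changes by `D` with a factor at most `N`, and the factor `N -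
n` changes by one against a control at most `K`. -/
theorem abs_gammaPlus_succ_sub_le (hD0 : 0 ≤ D) (hβ : ∀ i, ∀ m ≤ N, β i m t ∈ Icc 0 K)
    (hD : ∀ i m, m + 1 ≤ N → |β i (m + 1) t - β i m t| ≤ D) (i : Fin 2) (hn : n + 1 ≤ N) :
    |gammaPlus N β i (n + 1) t - gammaPlus N β i n t| ≤ N * D + K := by
  unfold gammaPlus
  have h0 := hβ 1 (n + 1 - i) (by omega)
  have habs : |-β 1 (n + 1 - i) t| ≤ K := by rw [abs_neg, abs_of_nonneg h0.1]; exact h0.2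
  have hi : n + 1 + 1 - (i : ℕ) = (n + 1 - i) + 1 := by omega
  rcases hn.eq_or_lt with h | h
  · have : ((N : ℝ) - ((n + 1 : ℕ) : ℝ)) = 0 := by rw [h, sub_self]
    have h' : (N : ℝ) - n = 1 := by rw [← h]; push_cast; ring
    rw [this, h', zero_mul, one_mul, zero_sub]
    have : 0 ≤ N * D := by positivity
    linarith
  · rw [hi]
    have := abs_mul_add_le (a := (N : ℝ) - (n + 1)) (x := N) (abs_le.2 ⟨?_, ?_⟩)
      (hD 1 (n + 1 - i) (by omega)) habs
    · convert this using 2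
      push_cast; ring
    · have : ((n + 1 : ℕ) : ℝ) ≤ N := by exact_mod_cast hn
      push_cast at this
      linarith [N.cast_nonneg (α := ℝ)]
    · linarith [n.cast_nonneg (α := ℝ)]

theorem abs_gammaMinus_succ_sub_le (hD0 : 0 ≤ D) (hβ : ∀ i, ∀ m ≤ N, β i m t ∈ Icc 0 K)
    (hD : ∀ i m, m + 1 ≤ N → |β i (m + 1) t - β i m t| ≤ D) (i : Fin 2) (hn : n + 1 ≤ N) :
    |gammaMinus β i (n + 1) t - gammaMinus β i n t| ≤ N * D + K := by
  unfold gammaMinus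
  have h0 := hβ 0 (n + 1 - i) (by omega)
  have habs : |β 0 (n + 1 - i) t| ≤ K := by rw [abs_of_nonneg h0.1]; exact h0.2
  -- For `n = 0` and `i = 1` truncated subtraction makes both indices zero, so this case is treated
  -- separately.
  rcases Nat.eq_zero_or_pos n with h | h
  · subst h
    have : 0 ≤ N * D := by positivity
    simp only [zero_add, Nat.cast_one, one_mul, Nat.cast_zero, zero_mul, sub_zero] at *
    linarith
  · have hi : n + 1 - (i : ℕ) = (n - i) + 1 := by omega
    have hnN : (n : ℝ) ≤ N := by exact_mod_cast (by omega : n ≤ N)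
    have h1 := hD 0 (n - i) (by omega)
    rw [← hi] at h1
    have := abs_mul_add_le (a := (n : ℝ)) (x := N) (by rwa [abs_of_nonneg (by positivity)]) h1 habs
    convert this using 2
    push_cast; ring

/-- The reference state only shifts the index of the control by one. For `D = O(1/N)` its effect on
the rate is thus `O(1)`. -/
theorem abs_gammaPlus_sub_le (hD0 : 0 ≤ D)
    (hD : ∀ i m, m + 1 ≤ N → |β i (m + 1) t - β i m t| ≤ D) (i j : Fin 2) (hn : n ≤ N) :
    |gammaPlus N β i n t - gammaPlus N β j n t| ≤ N * D := by
  unfold gammaPlus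
  rw [← mul_sub, abs_mul]
  have hn' : (0 : ℝ) ≤ (N : ℝ) - n := sub_nonneg.2 (by exact_mod_cast hn)
  rcases hn.eq_or_lt with rfl | h
  · rw [sub_self, abs_zero, zero_mul]; positivity
  · refine mul_le_mul (by rw [abs_of_nonneg hn']; linarith [n.cast_nonneg (α := ℝ)]) ?_
      (abs_nonneg _) (by positivity)
    have := hD 1 n h
    fin_cases i <;> fin_cases j <;> simp_all [abs_sub_comm]

theorem abs_gammaMinus_sub_le (hD0 : 0 ≤ D)
    (hD : ∀ i m, m + 1 ≤ N → |β i (m + 1) t - β i m t| ≤ D) (i j : Fin 2) (hn : n ≤ N) :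
    |gammaMinus β i n t - gammaMinus β j n t| ≤ N * D := by
  unfold gammaMinus
  rw [← mul_sub, abs_mul]
  cases n with
  | zero => rw [Nat.cast_zero, abs_zero, zero_mul]; positivity
  | succ m =>
    refine mul_le_mul (by rw [abs_of_nonneg (by positivity)]; exact_mod_cast hn) ?_
      (abs_nonneg _) (by positivity)
    have := hD 0 m hn
    fin_cases i <;> fin_cases j <;> simp_all [abs_sub_comm]

/-- The jump terms of the generator are nonnegative at a minimum. -/
theorem gamma_terms_nonneg (hβ : ∀ i, ∀ m ≤ N, β i m t ∈ Icc 0 K) (i : Fin 2) (hn : n ≤ N)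
    {f : ℕ → ℝ} (hf : ∀ m ≤ N, f n ≤ f m) :
    0 ≤ gammaPlus N β i n t * (f (n + 1) - f n) + gammaMinus β i n t * (f (n - 1) - f n) := by
  refine add_nonneg ?_
    (mul_nonneg (gammaMinus_mem hβ i hn).1 (sub_nonneg.2 (hf _ (by omega))))
  rcases hn.eq_or_lt with rfl | h
  · simp [gammaPlus]
  · exact mul_nonneg (gammaPlus_mem hβ i hn).1 (sub_nonneg.2 (hf _ h))

end Gamma

/-! ### A priori bounds and the gradient estimate -/

section Solutions

variable {c : Fin 2 → ℝ → ℝ → ℝ} {ψ : Fin 2 → ℝ → ℝ} {P K T : ℝ}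

/-- At the state of smaller value the momentum is nonnegative, so the Hamiltonian is too, which
gives the lower bound. Above, the terminal value and the Hamiltonian contribute at most `P / 2`
each, as `T ≤ 1`. -/
theorem meanField_bounds (hb : DataBounds c ψ P K) (hT0 : 0 ≤ T) (hT : T ≤ 1) {θbar : ℝ}
    {u : Fin 2 → ℝ → ℝ} {θ : ℝ → ℝ} (hu : IsMeanFieldSolution c ψ T θbar u θ) :
    ∀ i, ∀ t ∈ Icc 0 T, u i t ∈ Icc 0 P := by
  have hP := hb.bound_nonneg
  intro i t ht
  have hTT : T ∈ Icc 0 T := ⟨hT0, le_rfl⟩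
  constructor
  · have := le_of_backward_min (m := 0) (R := 0) hu.hj
      (fun x => by rw [hu.terminal]; exact (hb.psi_mem x _ (hu.mem T hTT)).1)
      (fun s hs x hx => by
        have h1 := hb.ham_ge x (u (1 - x) s - u x s) _ (hu.mem s hs)
        have h2 := mul_nonneg (hb.rate_nonneg x (u (1 - x) s - u x s) _ (hu.mem s hs))
          (sub_nonneg.2 (hx (1 - x)))
        linarith) i t ht
    linarith
  · have := le_of_backward_min (w := fun x t => -u x t) (m := -(P / 2)) (R := P / 2)
      (fun x s hs => (hu.hj x s hs).neg)
      (fun x => by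
        rw [hu.terminal]
        exact neg_le_neg (hb.psi_mem x _ (hu.mem T hTT)).2)
      (fun s hs x hx => by
        rw [neg_neg]
        exact hb.ham_le x _ _ (hu.mem s hs)) i t ht
    nlinarith [ht.1, ht.2]

theorem nPlayer_bounds (hb : DataBounds c ψ P K) (hT : T ≤ 1) {N : ℕ}
    {u : Fin 2 → ℕ → ℝ → ℝ} (hu : IsNPlayerSolution c ψ T N u) :
    ∀ i, ∀ n ≤ N, ∀ t ∈ Icc 0 T, u i n t ∈ Icc 0 P := by
  have hP := hb.bound_nonneg
  -- The uniform bound on the controls presupposes bounded momenta, which are not yet known. Only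
  -- finiteness at each time is needed, since the jump terms enter through their sign.
  have hβ : ∀ t, ∃ K, ∀ i, ∀ m ≤ N, feedbackControl c N u i m t ∈ Icc 0 K := by
    intro t
    obtain ⟨B, hB⟩ := (Set.finite_range fun x : Fin 2 × Fin (N + 1) =>
      feedbackControl c N u x.1 x.2 t).bddAbove
    exact ⟨B, fun i m hm => ⟨hb.rate_nonneg i _ _ (natCast_div_mem_unit hm),
      hB ⟨(i, ⟨m, by omega⟩), rfl⟩⟩⟩
  intro i n hn t ht
  have hle : ∀ x : Fin 2 × Fin (N + 1), (x.2 : ℕ) ≤ N := fun x => by omega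
  constructor
  · have := le_of_backward_min (ι := Fin 2 × Fin (N + 1)) (w := fun x t => u x.1 x.2 t)
      (m := 0) (R := 0) (fun x => hu.hj x.1 x.2 (hle x))
      (fun x => by
        rw [hu.terminal x.1 _ (hle x)]
        exact (hb.psi_mem _ _ (natCast_div_mem_unit (hle x))).1)
      (fun s hs x hx => by
        obtain ⟨B, hB⟩ := hβ s
        have h0 := gamma_terms_nonneg hB x.1 (hle x) (f := fun m => u x.1 m s)
          (fun m hm => hx (x.1, ⟨m, by omega⟩))
        have h1 := hb.ham_ge x.1 (u (1 - x.1) x.2 s - u x.1 x.2 s) _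
          (natCast_div_mem_unit (hle x))
        have h2 := mul_nonneg (hb.rate_nonneg x.1 (u (1 - x.1) x.2 s - u x.1 x.2 s) _
          (natCast_div_mem_unit (hle x))) (sub_nonneg.2 (hx (1 - x.1, x.2)))
        dsimp only at h2
        linarith) (i, ⟨n, by omega⟩) t ht
    dsimp only at this
    linarith
  · have := le_of_backward_min (ι := Fin 2 × Fin (N + 1)) (w := fun x t => -u x.1 x.2 t)
      (m := -(P / 2)) (R := P / 2) (fun x s hs => (hu.hj x.1 x.2 (hle x) s hs).neg)
      (fun x => by
        rw [hu.terminal x.1 _ (hle x)]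
        exact neg_le_neg (hb.psi_mem _ _ (natCast_div_mem_unit (hle x))).2)
      (fun s hs x hx => by
        obtain ⟨B, hB⟩ := hβ s
        have h0 := gamma_terms_nonneg hB x.1 (hle x) (f := fun m => -u x.1 m s)
          (fun m hm => hx (x.1, ⟨m, by omega⟩))
        have h1 := hb.ham_le x.1 (u (1 - x.1) x.2 s - u x.1 x.2 s) _
          (natCast_div_mem_unit (hle x))
        linarith) (i, ⟨n, by omega⟩) t ht
    dsimp only at this
    nlinarith [ht.1, ht.2]

theorem abs_sub_le_of_mem_Icc {a b : ℝ} (ha : a ∈ Icc 0 P) (hb : b ∈ Icc 0 P) : |a - b| ≤ P :=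
  abs_le.2 ⟨by linarith [ha.1, hb.2], by linarith [ha.2, hb.1]⟩

theorem feedbackControl_mem (hb : DataBounds c ψ P K) {N : ℕ} {u : Fin 2 → ℕ → ℝ → ℝ} {t : ℝ}
    (hu : ∀ i, ∀ n ≤ N, u i n t ∈ Icc 0 P) :
    ∀ i, ∀ n ≤ N, feedbackControl c N u i n t ∈ Icc 0 K := fun i n hn =>
  ⟨hb.rate_nonneg i _ _ (natCast_div_mem_unit hn),
    hb.rate_le i _ (abs_sub_le_of_mem_Icc (hu _ n hn) (hu _ n hn)) _ (natCast_div_mem_unit hn)⟩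

theorem succ_div_sub_div (n N : ℕ) : |((n + 1 : ℕ) : ℝ) / N - (n : ℝ) / N| = 1 / N := by
  rw [← sub_div, Nat.cast_add_one, add_sub_cancel_left, abs_of_nonneg (by positivity)]

theorem abs_momentum_sub_le {a b a' b' Z : ℝ} (h : |a - a'| ≤ Z) (h' : |b - b'| ≤ Z) :
    |(a - b) - (a' - b')| ≤ 2 * Z := by
  rw [abs_le] at *
  constructor <;> linarith [h.1, h.2, h'.1, h'.2]

theorem feedbackControl_succ_sub_le (hb : DataBounds c ψ P K) {N : ℕ}
    {u : Fin 2 → ℕ → ℝ → ℝ} {t Z : ℝ} (hZ : ∀ i n, n + 1 ≤ N → |u i (n + 1) t - u i n t| ≤ Z) :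
    ∀ i n, n + 1 ≤ N → |feedbackControl c N u i (n + 1) t - feedbackControl c N u i n t| ≤
      K * (2 * Z + 1 / N) := by
  intro i n hn
  have hK := hb.one_le
  refine (hb.rate_lip i _ _ _ (natCast_div_mem_unit hn) _
    (natCast_div_mem_unit (by omega))).trans ?_
  rw [succ_div_sub_div]
  gcongr
  exact abs_momentum_sub_le (hZ _ n hn) (hZ _ n hn)

/-- The rate of the barrier in the gradient estimate. -/
noncomputable def barrierSlope (K : ℝ) : ℝ := 4 * K * (K + 2) * (K + 3) + K * (2 * K + 5) + 1

/-- The gradient estimate: `u_n` is Lipschitz in `n / N`, uniformly in `N`, for small times. -/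
theorem nPlayer_gradient (hb : DataBounds c ψ P K) (hT : T ≤ 1)
    (hTs : T * barrierSlope K ≤ 1) {N : ℕ} (hN : 1 ≤ N)
    {u : Fin 2 → ℕ → ℝ → ℝ} (hu : IsNPlayerSolution c ψ T N u) :
    ∀ t ∈ Icc 0 T, ∀ i n, n + 1 ≤ N → |u i (n + 1) t - u i n t| ≤ (K + 2) / N := by
  have hK := hb.one_le
  have hN0 : (0 : ℝ) < N := by exact_mod_cast hN
  have hB0 : 0 < barrierSlope K := by unfold barrierSlope; positivity
  set B := barrierSlope K with hB
  have hbd := nPlayer_bounds hb hT hu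
  let σ : Bool → ℝ := fun b => if b then 1 else -1
  have hφ : ∀ t ∈ Icc 0 T, K + 1 + B * (T - t) ≤ K + 2 := by
    intro t ht
    nlinarith [ht.1]
  -- The barrier `φ / N` is compared with both signs of all increments. It starts at `(K + 1) / N`,
  -- above the increments of `ψ`, and stays below `(K + 2) / N` because `T * B ≤ 1`.
  have key := pos_of_backward_barrier (ι := Fin 2 × Fin N × Bool)
    (v := fun x t => (K + 1 + B * (T - t)) / N
      - σ x.2.2 * (u x.1 (x.2.1 + 1) t - u x.1 x.2.1 t)) (T := T)
    (fun x t ht => ((((hasDerivWithinAt_id t _).const_sub T).const_mul B).const_add (K + 1)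
      |>.div_const (N : ℝ)).sub (((hu.hj x.1 (x.2.1 + 1) (by omega) t ht).sub
        (hu.hj x.1 x.2.1 (by omega) t ht)).const_mul (σ x.2.2))) ?_ ?_
  · intro t ht i n hn
    have h1 := key (i, ⟨n, by omega⟩, true) t ht
    have h2 := key (i, ⟨n, by omega⟩, false) t ht
    simp only [σ, if_true, Bool.false_eq_true, if_false] at h1 h2
    have h3 : (K + 1 + B * (T - t)) / N ≤ (K + 2) / N :=
      div_le_div_of_nonneg_right (hφ t ht) hN0.le
    rw [abs_le]
    constructor <;> linarith
  · intro x
    obtain ⟨i, ⟨n, hn⟩, b⟩ := x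
    have h1 := hb.psi_lip i _ (natCast_div_mem_unit (n := n + 1) hn) _
      (natCast_div_mem_unit (n := n) hn.le)
    rw [succ_div_sub_div, abs_le] at h1
    dsimp only
    rw [hu.terminal i _ hn, hu.terminal i _ hn.le, sub_self, mul_zero, add_zero, add_div]
    have h2 : 0 < 1 / (N : ℝ) := by positivity
    have h3 : K / N = K * (1 / N) := by ring
    cases b <;> simp only [σ, if_true, Bool.false_eq_true, if_false] <;> linarith [h1.1, h1.2]
  · intro t ht x h0 hy
    obtain ⟨i, ⟨n, hn⟩, b⟩ := x
    dsimp only at h0 hy ⊢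
    set φ := K + 1 + B * (T - t) with hφd
    have hφle := hφ t ht
    have hφ0 : 0 ≤ φ := by
      have : 0 ≤ B * (T - t) := mul_nonneg hB0.le (by linarith [ht.2])
      linarith
    have hZ : ∀ j m, m + 1 ≤ N → |u j (m + 1) t - u j m t| ≤ φ / N := by
      intro j m hm
      have h1 := hy (j, ⟨m, hm⟩, true)
      have h2 := hy (j, ⟨m, hm⟩, false)
      simp only [σ, if_true, Bool.false_eq_true, if_false] at h1 h2
      rw [abs_le]
      constructor <;> linarith
    have hσ : |σ b| = 1 := by cases b <;> simp [σ]
    have hσZ : ∀ j m, m + 1 ≤ N → σ b * (u j (m + 1) t - u j m t) ≤ φ / N := by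
      intro j m hm
      refine (le_abs_self _).trans ?_
      rw [abs_mul, hσ, one_mul]
      exact hZ j m hm
    have hut : ∀ i, ∀ n ≤ N, u i n t ∈ Icc 0 P := fun i n hn => hbd i n hn t ht
    have hβ := feedbackControl_mem hb hut
    have hD := feedbackControl_succ_sub_le hb hZ
    have hD0 : 0 ≤ K * (2 * (φ / N) + 1 / N) := by positivity
    have g1 := abs_gammaPlus_succ_sub_le hD0 hβ hD i hn
    have g2 := abs_gammaMinus_succ_sub_le hD0 hβ hD i hn
    have g3 := (gammaPlus_mem hβ i (show n + 1 ≤ N from hn)).1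
    have g4 := (gammaMinus_mem hβ i hn.le).1
    have g5 := hb.ham_lip i _ _ (abs_sub_le_of_mem_Icc (hut (1 - i) _ hn) (hut i _ hn))
      (abs_sub_le_of_mem_Icc (hut (1 - i) _ hn.le) (hut i _ hn.le)) _
      (natCast_div_mem_unit (n := n + 1) hn) _ (natCast_div_mem_unit (n := n) hn.le)
    rw [succ_div_sub_div] at g5
    have g6 := abs_momentum_sub_le (hZ (1 - i) n hn) (hZ i n hn)
    -- At the touching point neighbouring increments are at most `φ / N`. The large rates then
    -- appear only through their differences in `n`, which are `O(1)`.
    have e1 : gammaPlus N (feedbackControl c N u) i (n + 1) t *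
        (σ b * (u i (n + 1 + 1) t - u i (n + 1) t)) ≤
        gammaPlus N (feedbackControl c N u) i (n + 1) t * (φ / N) := by
      rcases (show n + 1 ≤ N from hn).eq_or_lt with h | h
      · simp [gammaPlus, h]
      · exact mul_le_mul_of_nonneg_left (hσZ i (n + 1) h) g3
    have e2 : gammaMinus (feedbackControl c N u) i n t * (σ b * (u i n t - u i (n - 1) t)) ≤
        gammaMinus (feedbackControl c N u) i n t * (φ / N) := by
      cases n with
      | zero => simp [gammaMinus]
      | succ m => exact mul_le_mul_of_nonneg_left (hσZ i m hn.le) g4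
    set H₁ := hamiltonian c (u (1 - i) (n + 1) t - u i (n + 1) t) (((n + 1 : ℕ) : ℝ) / N) i
    set H₀ := hamiltonian c (u (1 - i) n t - u i n t) ((n : ℝ) / N) i
    have e3 : σ b * (H₁ - H₀) ≤ K * (2 * (φ / N) + 1 / N) := by
      refine (le_abs_self _).trans ?_
      rw [abs_mul, hσ, one_mul]
      exact g5.trans (by gcongr)
    have hz : σ b * (u i (n + 1) t - u i n t) = φ / N := by linarith
    set G₁ := gammaPlus N (feedbackControl c N u) i (n + 1) t
    set G₀ := gammaPlus N (feedbackControl c N u) i n t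
    set F₁ := gammaMinus (feedbackControl c N u) i (n + 1) t
    set F₀ := gammaMinus (feedbackControl c N u) i n t
    rw [add_tsub_cancel_right]
    have e4 : (G₁ - G₀ - (F₁ - F₀)) * (φ / N) ≤
        (2 * (N * (K * (2 * (φ / N) + 1 / N)) + K)) * (φ / N) := by
      gcongr
      linarith [le_abs_self (G₁ - G₀), neg_abs_le (F₁ - F₀)]
    have e5 : (2 * (N * (K * (2 * (φ / N) + 1 / N)) + K)) * (φ / N)
        + K * (2 * (φ / N) + 1 / N) = (4 * K * φ * (φ + 1) + K * (2 * φ + 1)) / N := by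
      field_simp
      ring
    -- `barrierSlope` is the numerator on the left at `φ = K + 2`, plus one for strictness.
    have e6 : (4 * K * φ * (φ + 1) + K * (2 * φ + 1)) / N < B / N := by
      gcongr
      rw [hB, barrierSlope]
      have : K * φ * (φ + 1) ≤ K * (K + 2) * (K + 3) :=
        mul_le_mul (mul_le_mul_of_nonneg_left hφle (by linarith)) (by linarith) (by linarith)
          (by positivity)
      nlinarith
    have e7 : σ b * (G₀ * (u i (n + 1) t - u i n t)) = G₀ * (φ / N) := by rw [← hz]; ring
    have e8 : σ b * (F₁ * (u i n t - u i (n + 1) t)) = - (F₁ * (φ / N)) := by rw [← hz]; ring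
    have e9 : (B * -1) / N = - (B / N) := by ring
    rw [e9]
    linarith

end Solutions

/-! ### Forward equation and Dynkin's formula for a finite chain -/

section Chain

variable {S Ω : Type*} [MeasurableSpace Ω] {μ : Measure Ω} {X : ℝ → Ω → S} {T : ℝ}
  {r : S → S → ℝ → ℝ}

/-- The probability that `X t = x`. -/
noncomputable def law (μ : Measure Ω) (X : ℝ → Ω → S) (x : S) (t : ℝ) : ℝ :=
  μ.real {ω | X t ω = x}

theorem law_nonneg (x : S) (t : ℝ) : 0 ≤ law μ X x t := measureReal_nonneg

variable [IsProbabilityMeasure μ]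

theorem law_le_one (x : S) (t : ℝ) : law μ X x t ≤ 1 := measureReal_le_one

/-- The rate condition for a process with finitely many states: transitions from `x` to `y ≠ x`
occur with rate `r x y`, uniformly on `[0,T]`. -/
def HasJumpRate (μ : Measure Ω) (X : ℝ → Ω → S) (T : ℝ) (r : S → S → ℝ → ℝ) : Prop :=
  ∀ ε > 0, ∃ δ > 0, ∀ t h : ℝ, 0 ≤ t → 0 < h → h < δ → t + h ≤ T → ∀ x y, y ≠ x →
    μ {ω | X t ω = x} ≠ 0 →
      |(μ[|{ω | X t ω = x}]).real {ω | X (t + h) ω = y} - h * r x y t| ≤ ε * h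

theorem joint_sub_le [MeasurableSpace S] [MeasurableSingletonClass S] {t h ε : ℝ}
    (hX : Measurable (X t)) (hh : 0 ≤ h) (hε : 0 ≤ ε) {x y : S}
    (hr : μ {ω | X t ω = x} ≠ 0 →
      |(μ[|{ω | X t ω = x}]).real {ω | X (t + h) ω = y} - h * r x y t| ≤ ε * h) :
    |μ.real ({ω | X t ω = x} ∩ {ω | X (t + h) ω = y}) - h * (law μ X x t * r x y t)|
      ≤ ε * h := by
  have hm : MeasurableSet {ω | X t ω = x} := hX (measurableSet_singleton x)
  by_cases h0 : μ {ω | X t ω = x} = 0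
  · have h1 : μ.real ({ω | X t ω = x} ∩ {ω | X (t + h) ω = y}) = 0 := by
      rw [measureReal_def, measure_mono_null inter_subset_left h0, ENNReal.toReal_zero]
    have h2 : law μ X x t = 0 := by rw [law, measureReal_def, h0, ENNReal.toReal_zero]
    rw [h1, h2]
    simp only [zero_mul, mul_zero, sub_zero, abs_zero]
    positivity
  · have h1 := hr h0
    have hp : law μ X x t ≠ 0 := by
      rw [law, measureReal_def]
      exact ENNReal.toReal_ne_zero.2 ⟨h0, measure_ne_top _ _⟩
    rw [measureReal_def, cond_apply hm, ENNReal.toReal_mul, ENNReal.toReal_inv] at h1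
    change |(law μ X x t)⁻¹ * μ.real ({ω | X t ω = x} ∩ {ω | X (t + h) ω = y}) - _| ≤ _ at h1
    have h2 : μ.real ({ω | X t ω = x} ∩ {ω | X (t + h) ω = y}) - h * (law μ X x t * r x y t) =
        law μ X x t * ((law μ X x t)⁻¹ * μ.real ({ω | X t ω = x} ∩ {ω | X (t + h) ω = y})
          - h * r x y t) := by
      field_simp
    rw [h2, abs_mul, abs_of_nonneg (law_nonneg x t)]
    calc law μ X x t * _ ≤ 1 * (ε * h) :=
          mul_le_mul (law_le_one x t) h1 (abs_nonneg _) zero_le_one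
      _ = ε * h := one_mul _

variable [Fintype S]

/-- The net probability flow into the state `y`. -/
noncomputable def flow (μ : Measure Ω) (X : ℝ → Ω → S) (r : S → S → ℝ → ℝ) (y : S) (t : ℝ) : ℝ :=
  ∑ x, (law μ X x t * r x y t - law μ X y t * r y x t)

theorem abs_flow_le {R t : ℝ} (hR : ∀ x y, y ≠ x → |r x y t| ≤ R) (hR0 : 0 ≤ R) (y : S) :
    |flow μ X r y t| ≤ Fintype.card S * (2 * R) := by
  calc |flow μ X r y t| ≤ ∑ x, |law μ X x t * r x y t - law μ X y t * r y x t| :=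
        Finset.abs_sum_le_sum_abs _ _
    _ ≤ ∑ _x : S, 2 * R := by
        refine Finset.sum_le_sum fun x _ => ?_
        rcases eq_or_ne x y with rfl | hxy
        · rw [sub_self, abs_zero]; positivity
        · refine (abs_sub _ _).trans ?_
          rw [abs_mul, abs_mul, abs_of_nonneg (law_nonneg x t), abs_of_nonneg (law_nonneg y t)]
          have e1 := mul_le_mul (law_le_one (μ := μ) (X := X) x t) (hR x y hxy.symm)
            (abs_nonneg _) zero_le_one
          have e2 := mul_le_mul (law_le_one (μ := μ) (X := X) y t) (hR y x hxy)
            (abs_nonneg _) zero_le_one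
          linarith
    _ = Fintype.card S * (2 * R) := by rw [Finset.sum_const, nsmul_eq_mul, Finset.card_univ]

variable [MeasurableSpace S] [MeasurableSingletonClass S]

theorem integral_comp_eq_sum_law {t : ℝ} (hX : Measurable (X t)) (f : S → ℝ) :
    ∫ ω, f (X t ω) ∂μ = ∑ x, law μ X x t * f x := by
  have hf : Measurable f := measurable_of_finite f
  rw [← integral_map (f := f) hX.aemeasurable hf.aestronglyMeasurable]
  have : IsFiniteMeasure (μ.map (X t)) := Measure.isFiniteMeasure_map μ (X t)
  rw [integral_fintype (Integrable.of_finite)]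
  refine Finset.sum_congr rfl fun x _ => ?_
  rw [smul_eq_mul, map_measureReal_apply hX (measurableSet_singleton x)]
  rfl

theorem sum_law {t : ℝ} (hX : Measurable (X t)) : ∑ x, law μ X x t = 1 := by
  have := integral_comp_eq_sum_law (μ := μ) hX fun _ => 1
  simpa using this.symm

theorem measureReal_eq_sum_inter {A : Set Ω} {f : Ω → S} (hf : Measurable f) :
    μ.real A = ∑ x, μ.real (A ∩ {ω | f ω = x}) := by
  have h := measureReal_biUnion_finset (μ := μ.restrict A) (s := Finset.univ)
    (f := fun x => {ω | f ω = x})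
    (fun x _ y _ hxy => Set.disjoint_left.2 fun ω h1 h2 => hxy (h1.symm.trans h2))
    (fun x _ => hf (measurableSet_singleton x))
  have hU : (⋃ x ∈ (Finset.univ : Finset S), {ω | f ω = x}) = univ := by ext; simp
  rw [hU, measureReal_restrict_apply MeasurableSet.univ, univ_inter] at h
  rw [h]
  refine Finset.sum_congr rfl fun x _ => ?_
  rw [measureReal_restrict_apply (show MeasurableSet {ω | f ω = x} from
    hf (measurableSet_singleton x)), inter_comm]

/-- Both laws are marginals of the joint law at the two times. In the difference the diagonal terms
cancel, so no expansion of the probability of staying put is needed. -/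
theorem law_increment_le {t h ε : ℝ} (hX : ∀ s ∈ Icc 0 T, Measurable (X s)) (ht : 0 ≤ t)
    (hh : 0 ≤ h) (hT : t + h ≤ T) (hε : 0 ≤ ε)
    (hr : ∀ x y, y ≠ x → μ {ω | X t ω = x} ≠ 0 →
      |(μ[|{ω | X t ω = x}]).real {ω | X (t + h) ω = y} - h * r x y t| ≤ ε * h) (y : S) :
    |law μ X y (t + h) - law μ X y t - h * flow μ X r y t| ≤ Fintype.card S * (2 * ε) * h := by
  have hX1 := hX t ⟨ht, by linarith⟩
  have hX2 := hX (t + h) ⟨by linarith, hT⟩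
  set m : S → S → ℝ := fun a b => μ.real ({ω | X t ω = a} ∩ {ω | X (t + h) ω = b}) with hm
  have h1 : law μ X y (t + h) = ∑ x, m x y := by
    rw [law, measureReal_eq_sum_inter hX1]
    exact Finset.sum_congr rfl fun x _ => by rw [inter_comm]
  have h2 : law μ X y t = ∑ x, m y x := by rw [law, measureReal_eq_sum_inter hX2]
  have h3 : law μ X y (t + h) - law μ X y t - h * flow μ X r y t =
      ∑ x, ((m x y - h * (law μ X x t * r x y t)) - (m y x - h * (law μ X y t * r y x t))) := by
    rw [flow, Finset.mul_sum, h1]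
    nth_rewrite 1 [h2]
    rw [← Finset.sum_sub_distrib, ← Finset.sum_sub_distrib]
    exact Finset.sum_congr rfl fun x _ => by ring
  rw [h3]
  calc _ ≤ ∑ x, |(m x y - h * (law μ X x t * r x y t)) - (m y x - h * (law μ X y t * r y x t))| :=
        Finset.abs_sum_le_sum_abs _ _
    _ ≤ ∑ _x : S, 2 * ε * h := by
        refine Finset.sum_le_sum fun x _ => ?_
        rcases eq_or_ne x y with rfl | hxy
        · rw [sub_self, abs_zero]; positivity
        · have e1 := joint_sub_le hX1 hh hε (hr x y hxy.symm)
          have e2 := joint_sub_le hX1 hh hε (hr y x hxy)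
          refine (abs_sub _ _).trans ?_
          linarith
    _ = Fintype.card S * (2 * ε) * h := by
        rw [Finset.sum_const, nsmul_eq_mul, Finset.card_univ]; ring

theorem law_hasDerivWithinAt (hX : ∀ s ∈ Icc 0 T, Measurable (X s)) (hr : HasJumpRate μ X T r)
    {t : ℝ} (ht : t ∈ Ico 0 T) (y : S) :
    HasDerivWithinAt (law μ X y) (flow μ X r y t) (Ici t) t := by
  rw [hasDerivWithinAt_iff_isLittleO, Asymptotics.isLittleO_iff]
  intro ε hε
  have hcard : (0 : ℝ) < 2 * Fintype.card S + 1 := by positivity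
  obtain ⟨δ, hδ, H⟩ := hr (ε / (2 * Fintype.card S + 1)) (by positivity)
  have hlt : t < min (t + δ) T := lt_min (by linarith) ht.2
  filter_upwards [Ico_mem_nhdsGE hlt] with s hs
  have hs2 := lt_min_iff.1 hs.2
  rcases hs.1.eq_or_lt with rfl | hts
  · simp
  have h1 := law_increment_le hX ht.1 (h := s - t) (by linarith) (by linarith)
    (by positivity) (H t (s - t) ht.1 (by linarith) (by linarith) (by linarith)) y
  rw [add_sub_cancel] at h1
  rw [Real.norm_eq_abs, Real.norm_eq_abs, smul_eq_mul, abs_of_pos (sub_pos.2 hts)]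
  refine h1.trans (mul_le_mul_of_nonneg_right ?_ (by linarith))
  rw [show (Fintype.card S : ℝ) * (2 * (ε / (2 * Fintype.card S + 1))) =
    ε * ((2 * Fintype.card S) / (2 * Fintype.card S + 1)) by ring]
  exact mul_le_of_le_one_right hε.le ((div_le_one hcard).2 (by linarith))

/-- The rate condition looks forward and yields right derivatives only; a mean value inequality also
needs continuity. The uniformity of `o(h)` in `t` and the bounded rates make the law Lipschitz at
small scales, on both sides. -/
theorem law_continuousOn (hX : ∀ s ∈ Icc 0 T, Measurable (X s)) (hr : HasJumpRate μ X T r)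
    {R : ℝ} (hR0 : 0 ≤ R) (hR : ∀ t ∈ Icc 0 T, ∀ x y, y ≠ x → |r x y t| ≤ R) (y : S) :
    ContinuousOn (law μ X y) (Icc 0 T) := by
  obtain ⟨δ, hδ, H⟩ := hr 1 one_pos
  set L : ℝ := Fintype.card S * (2 * 1) + Fintype.card S * (2 * R) with hL
  have hL0 : 0 ≤ L := by positivity
  have key : ∀ s ∈ Icc 0 T, ∀ t ∈ Icc 0 T, s < t → t - s < δ →
      |law μ X y t - law μ X y s| ≤ L * (t - s) := by
    intro s hs t ht hst hd
    have h1 := law_increment_le hX hs.1 (h := t - s) (by linarith) (by linarith [ht.2])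
      zero_le_one (H s (t - s) hs.1 (by linarith) hd (by linarith [ht.2])) y
    rw [add_sub_cancel] at h1
    have h2 := abs_flow_le (μ := μ) (X := X) (hR s hs) hR0 y
    have h3 : |(t - s) * flow μ X r y s| ≤ (t - s) * (Fintype.card S * (2 * R)) := by
      rw [abs_mul, abs_of_pos (sub_pos.2 hst)]
      exact mul_le_mul_of_nonneg_left h2 (by linarith)
    have h4 := abs_add_le (law μ X y t - law μ X y s - (t - s) * flow μ X r y s)
      ((t - s) * flow μ X r y s)
    rw [sub_add_cancel] at h4
    calc _ ≤ _ := h4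
      _ ≤ Fintype.card S * (2 * 1) * (t - s) + (t - s) * (Fintype.card S * (2 * R)) :=
        add_le_add h1 h3
      _ = L * (t - s) := by ring
  rw [Metric.continuousOn_iff]
  intro t ht ε hε
  refine ⟨min δ (ε / (L + 1)), by positivity, fun s hs hst => ?_⟩
  rw [Real.dist_eq] at hst ⊢
  obtain ⟨h1, h2⟩ := lt_min_iff.1 hst
  have hle : |law μ X y s - law μ X y t| ≤ L * |s - t| := by
    rcases lt_trichotomy s t with h | h | h
    · rw [abs_sub_comm, abs_sub_comm s t, abs_of_pos (sub_pos.2 h)] at *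
      exact key s hs t ht h h1
    · simp [h]
    · rw [abs_of_pos (sub_pos.2 h)] at *
      exact key t ht s hs h h1
  rw [lt_div_iff₀ (by positivity)] at h2
  nlinarith [abs_nonneg (s - t)]

/-- Dynkin's formula in differential form. -/
theorem sum_law_mul_hasDerivWithinAt (hX : ∀ s ∈ Icc 0 T, Measurable (X s))
    (hr : HasJumpRate μ X T r) {g g' : S → ℝ → ℝ} {t : ℝ} (ht : t ∈ Ico 0 T)
    (hg : ∀ x, HasDerivWithinAt (g x) (g' x t) (Icc 0 T) t) :
    HasDerivWithinAt (fun s => ∑ x, law μ X x s * g x s)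
      (∑ x, law μ X x t * (g' x t + ∑ y, r x y t * (g y t - g x t))) (Ici t) t := by
  have h := HasDerivWithinAt.fun_sum (u := Finset.univ) fun x _ =>
    (law_hasDerivWithinAt hX hr ht x).fun_mul (hasDerivWithinAt_Ici_of_Icc (hg x) ht)
  refine h.congr_deriv ?_
  symm
  simp only [mul_add, Finset.sum_add_distrib]
  rw [add_comm]
  congr 1
  simp only [flow, Finset.sum_mul, Finset.mul_sum, sub_mul, mul_sub, Finset.sum_sub_distrib]
  congr 1
  · rw [Finset.sum_comm]
    exact Finset.sum_congr rfl fun x _ => Finset.sum_congr rfl fun y _ => by ring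
  · exact Finset.sum_congr rfl fun x _ => Finset.sum_congr rfl fun y _ => by ring

end Chain

/-! ### The generator and initial law of the game process -/

section Chains

variable {N : ℕ} {K T t : ℝ} {β : Fin 2 → ℕ → ℝ → ℝ}

theorem one_sub_ne (i : Fin 2) : 1 - i ≠ i := by fin_cases i <;> decide

theorem abs_jumpRate_le (hN : 1 ≤ N) (hβ : ∀ i, ∀ m ≤ N, β i m t ∈ Icc 0 K)
    (x y : Fin 2 × Fin (N + 1)) : |jumpRate N β x y t| ≤ N * K := by
  have hx : (x.2 : ℕ) ≤ N := by omega
  have h0 := hβ x.1 x.2 hx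
  have hK : 0 ≤ K := h0.1.trans h0.2
  unfold jumpRate
  split_ifs
  · rw [abs_of_nonneg h0.1]
    have : (1 : ℝ) ≤ N := by exact_mod_cast hN
    nlinarith [h0.2]
  · have := gammaPlus_mem hβ x.1 hx
    rw [abs_of_nonneg this.1]
    exact this.2
  · have := gammaMinus_mem hβ x.1 hx
    rw [abs_of_nonneg this.1]
    exact this.2
  · rw [abs_zero]
    positivity

theorem sum_ite_eq_state (i : Fin 2) (m : ℕ) (v : ℝ) :
    (∑ y : Fin 2 × Fin (N + 1), if y.1 = i ∧ (y.2 : ℕ) = m then v else 0) =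
      if m ≤ N then v else 0 := by
  split_ifs with h
  · rw [Finset.sum_eq_single (i, (⟨m, by omega⟩ : Fin (N + 1)))]
    · simp
    · intro y _ hy
      rw [if_neg]
      rintro ⟨h1, h2⟩
      exact hy (Prod.ext h1 (Fin.ext h2))
    · simp
  · refine Finset.sum_eq_zero fun y _ => ?_
    rw [if_neg]
    rintro ⟨-, h2⟩
    omega

/-- The generator of the game process on functions of the number of players in state `0`. -/
theorem sum_jumpRate_mul (f : ℕ → ℝ) (x : Fin 2 × Fin (N + 1)) :
    ∑ y, jumpRate N β x y t * (f y.2 - f x.2) =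
      gammaPlus N β x.1 x.2 t * (f (x.2 + 1) - f x.2)
        + gammaMinus β x.1 x.2 t * (f (x.2 - 1) - f x.2) := by
  obtain ⟨i, n, hn⟩ := x
  have key : ∀ y : Fin 2 × Fin (N + 1), jumpRate N β (i, ⟨n, hn⟩) y t * (f y.2 - f n) =
      (if y.1 = i ∧ (y.2 : ℕ) = n + 1 then gammaPlus N β i n t * (f (n + 1) - f n) else 0)
      + (if y.1 = i ∧ (y.2 : ℕ) = n - 1 then gammaMinus β i n t * (f (n - 1) - f n) else 0) := by
    rintro ⟨j, m, hm⟩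
    simp only [jumpRate, Fin.mk.injEq]
    by_cases h1 : j = 1 - i ∧ m = n
    · obtain ⟨rfl, rfl⟩ := h1
      simp [one_sub_ne]
    rw [if_neg h1]
    by_cases h2 : j = i ∧ m = n + 1
    · obtain ⟨rfl, rfl⟩ := h2
      have : ¬ (n + 1 = n - 1) := by omega
      simp [this]
    rw [if_neg h2, if_neg h2, zero_add]
    by_cases h3 : j = i ∧ m + 1 = n
    · obtain ⟨rfl, rfl⟩ := h3
      simp
    rw [if_neg h3, zero_mul]
    -- Only `n = 0` is left, where the truncated `n - 1` equals `n` and the difference vanishes.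
    split_ifs with h4
    · have hn0 : n = 0 := by
        by_contra h0
        exact h3 ⟨h4.1, by omega⟩
      simp [hn0]
    · rfl
  dsimp only
  rw [Finset.sum_congr rfl fun y _ => key y, Finset.sum_add_distrib, sum_ite_eq_state,
    sum_ite_eq_state, if_pos (show n - 1 ≤ N by omega)]
  congr 1
  split_ifs with h
  · rfl
  · have : n = N := by omega
    simp [gammaPlus, this]

variable {Ω : Type*} [MeasurableSpace Ω] {μ : Measure Ω} [IsProbabilityMeasure μ]
  {X : ℝ → Ω → Fin 2 × Fin (N + 1)}

theorem IsGameProcess.law_continuousOn (hX : IsGameProcess μ T N β X) (hN : 1 ≤ N)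
    (hβ : ∀ t ∈ Icc 0 T, ∀ i, ∀ m ≤ N, β i m t ∈ Icc 0 K) (y : Fin 2 × Fin (N + 1)) :
    ContinuousOn (law μ X y) (Icc 0 T) := by
  refine TwoStateGame.law_continuousOn hX.measurable hX.rate (R := N * |K|) (by positivity)
    (fun t ht x y _ => (abs_jumpRate_le hN (hβ t ht) x y).trans ?_) y
  gcongr
  exact le_abs_self K

/-- Growth bound for the expectation of a function of the number of players in state `0`. -/
theorem IsGameProcess.abs_expectation_sub_le (hX : IsGameProcess μ T N β X) (hN : 1 ≤ N)
    (hβ : ∀ t ∈ Icc 0 T, ∀ i, ∀ m ≤ N, β i m t ∈ Icc 0 K) {g g' : ℕ → ℝ → ℝ}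
    (hg : ∀ n ≤ N, ∀ t ∈ Icc 0 T, HasDerivWithinAt (g n) (g' n t) (Icc 0 T) t)
    {k : Fin 2 × Fin (N + 1) → ℝ → ℝ} {M : ℝ}
    (hk : ∀ t ∈ Icc 0 T, ∀ x : Fin 2 × Fin (N + 1),
      |g' x.2 t + (gammaPlus N β x.1 x.2 t * (g (x.2 + 1) t - g x.2 t)
        + gammaMinus β x.1 x.2 t * (g (x.2 - 1) t - g x.2 t))| ≤ k x t)
    (hM : ∀ t ∈ Icc 0 T, ∑ x, law μ X x t * k x t ≤ M) {s t : ℝ} (hs : 0 ≤ s) (hst : s ≤ t)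
    (ht : t ≤ T) :
    |∑ x, law μ X x t * g x.2 t - ∑ x, law μ X x s * g x.2 s| ≤ M * (t - s) := by
  have hle : ∀ x : Fin 2 × Fin (N + 1), (x.2 : ℕ) ≤ N := fun x => by omega
  have hcont : ContinuousOn (fun t => ∑ x, law μ X x t * g x.2 t) (Icc 0 T) :=
    continuousOn_finsetSum _ fun x _ => (hX.law_continuousOn hN hβ x).mul fun r hr =>
      (hg x.2 (hle x) r hr).continuousWithinAt
  refine norm_image_sub_le_of_norm_deriv_right_le_segment (a := s) (b := t)
    (f := fun t => ∑ x, law μ X x t * g x.2 t) (hcont.mono (Icc_subset_Icc hs ht))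
    (fun r hr => sum_law_mul_hasDerivWithinAt (g := fun x => g x.2) (g' := fun x => g' x.2)
      hX.measurable hX.rate ⟨hs.trans hr.1, hr.2.trans_le ht⟩
      (fun x => hg x.2 (hle x) r ⟨hs.trans hr.1, hr.2.le.trans ht⟩)) (fun r hr => ?_)
    t ⟨hst, le_rfl⟩
  have hrT : r ∈ Icc 0 T := ⟨hs.trans hr.1, hr.2.le.trans ht⟩
  refine (Finset.abs_sum_le_sum_abs _ _).trans ((Finset.sum_le_sum fun x _ => ?_).trans
    (hM r hrT))
  rw [abs_mul, abs_of_nonneg (law_nonneg x r),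
    sum_jumpRate_mul (fun n => g n r) x]
  exact mul_le_mul_of_nonneg_left (hk r hrT x) (law_nonneg x r)

/-- The variance of a binomial proportion is at most `1 / N`. -/
theorem sum_binomial_le {p : ℝ} (hp : p ∈ Icc (0 : ℝ) 1) (hN : 1 ≤ N) {n : Ω → Fin (N + 1)}
    (hn : Measurable n) (hbin : IsBinomial μ N p n) :
    ∫ ω, ((n ω : ℕ) / (N : ℝ) - p) ^ 2 ∂μ ≤ 1 / N := by
  rw [integral_comp_eq_sum_law (X := fun _ => n) (t := 0) hn
    (fun k => ((k : ℕ) / (N : ℝ) - p) ^ 2)]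
  -- The binomial weights are the Bernstein polynomials at `p`, whose variance is `p (1 - p) / N`.
  have h := bernstein.variance (n := N) (by omega) ⟨p, hp⟩
  have h2 : ∑ k : Fin (N + 1), law μ (fun _ => n) k 0 * ((k : ℕ) / (N : ℝ) - p) ^ 2
      = p * (1 - p) / N := by
    rw [← h]
    refine Finset.sum_congr rfl fun k _ => ?_
    rw [bernstein_apply, law, hbin k, bernstein.z]
    ring
  rw [h2]
  gcongr
  nlinarith [hp.1, hp.2]

end Chains

/-! ### Generator estimates for the squared deviations -/

section Convergence

variable {c : Fin 2 → ℝ → ℝ → ℝ} {ψ : Fin 2 → ℝ → ℝ} {P K T θbar : ℝ} {N : ℕ}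
  {u : Fin 2 → ℝ → ℝ} {θ : ℝ → ℝ} {uN : Fin 2 → ℕ → ℝ → ℝ}

/-- The squared distance between the mean field and the `N`-player quantities, in state `n`. -/
noncomputable def gap (N : ℕ) (u : Fin 2 → ℝ → ℝ) (θ : ℝ → ℝ) (uN : Fin 2 → ℕ → ℝ → ℝ) (n : ℕ)
    (t : ℝ) : ℝ :=
  ((n : ℝ) / N - θ t) ^ 2 + (u 0 t - uN 0 n t) ^ 2 + (u 1 t - uN 1 n t) ^ 2

/-- The constant in the differential inequalities for `V_N` and `Q_N`. -/
noncomputable def growthConst (P K : ℝ) : ℝ :=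
  24 * K + 4 * (K * (2 * (K + 2) + 1)) + 2 * K
    + 4 * (P * (K * (2 * (K + 2) + 1)) * (K + 2)) + 2 * (K * (K + 2) ^ 2)

theorem momentum_gap_le {a b a' b' : ℝ} : |(a - b) - (a' - b')| ≤ |a - a'| + |b - b'| := by
  have : (a - b) - (a' - b') = (a - a') - (b - b') := by ring
  rw [this]
  exact abs_sub _ _

theorem abs_mul_sum_le (x y z : ℝ) :
    |x| * (|y| + |z| + |x|) ≤ 3 * (x ^ 2 + y ^ 2 + z ^ 2) := by
  rw [← sq_abs x, ← sq_abs y, ← sq_abs z]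
  nlinarith [sq_nonneg (|x| - |y|), sq_nonneg (|x| - |z|), sq_nonneg |x|, sq_nonneg |y|,
    sq_nonneg |z|]

/-- The generator applied to the square deviation of the empirical distribution. -/
theorem abs_generator_state_le (hb : DataBounds c ψ P K) (hN : 1 ≤ N) {t : ℝ}
    (hθ : θ t ∈ Icc (0 : ℝ) 1) (hu : ∀ i, u i t ∈ Icc 0 P)
    (huN : ∀ i, ∀ n ≤ N, uN i n t ∈ Icc 0 P)
    (hgrad : ∀ i n, n + 1 ≤ N → |uN i (n + 1) t - uN i n t| ≤ (K + 2) / N)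
    (I : Fin 2) {n : ℕ} (hn : n ≤ N) :
    |2 * ((n : ℝ) / N - θ t) * (0 - ((1 - θ t) * optimalRate c (u 0 t - u 1 t) (θ t) 1
        - θ t * optimalRate c (u 1 t - u 0 t) (θ t) 0))
      + (gammaPlus N (feedbackControl c N uN) I n t *
          ((((n + 1 : ℕ) : ℝ) / N - θ t) ^ 2 - ((n : ℝ) / N - θ t) ^ 2)
        + gammaMinus (feedbackControl c N uN) I n t *
          ((((n - 1 : ℕ) : ℝ) / N - θ t) ^ 2 - ((n : ℝ) / N - θ t) ^ 2))|
      ≤ growthConst P K * (gap N u θ uN n t + 1 / N) := by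
  have hK := hb.one_le
  have hP := hb.bound_nonneg
  have hN0 : (0 : ℝ) < N := by exact_mod_cast hN
  have hβ := feedbackControl_mem hb huN
  have hD := feedbackControl_succ_sub_le hb hgrad
  set β := feedbackControl c N uN with hβd
  set d := K * (2 * (K + 2) + 1) with hd
  have hD' : K * (2 * ((K + 2) / N) + 1 / N) = d / N := by rw [hd]; field_simp
  rw [hD'] at hD
  have hD0 : 0 ≤ d / N := by positivity
  have gp := gammaPlus_mem hβ I hn
  have gm := gammaMinus_mem hβ I hn
  have dp := abs_gammaPlus_sub_le hD0 hD I 1 hn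
  have dm := abs_gammaMinus_sub_le hD0 hD I 0 hn
  have hNd : N * (d / N) = d := by field_simp
  rw [hNd] at dp dm
  -- In these reference states the index shift disappears, and the rates take the form of the mean
  -- field drift.
  have hp1 : gammaPlus N β 1 n t = (N - n) * β 1 n t := by simp [gammaPlus]
  have hm0 : gammaMinus β 0 n t = n * β 0 n t := by simp [gammaMinus]
  rw [hp1] at dp
  rw [hm0] at dm
  set y := (n : ℝ) / N - θ t with hy
  have hν := natCast_div_mem_unit hn
  have hy1 : |y| ≤ 1 := abs_sub_le_one_of_mem_unit hν hθ
  set e0 := u 0 t - uN 0 n t with he0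
  set e1 := u 1 t - uN 1 n t with he1
  set w := |e0| + |e1| + |y| with hw
  have r1 : |β 1 n t - optimalRate c (u 0 t - u 1 t) (θ t) 1| ≤ K * w := by
    refine (hb.rate_lip 1 _ _ _ hν _ hθ).trans ?_
    gcongr
    rw [hw]
    gcongr
    refine momentum_gap_le.trans (le_of_eq ?_)
    rw [he0, he1, abs_sub_comm (u 0 t), abs_sub_comm (u 1 t)]
    simp
  have r0 : |β 0 n t - optimalRate c (u 1 t - u 0 t) (θ t) 0| ≤ K * w := by
    refine (hb.rate_lip 0 _ _ _ hν _ hθ).trans ?_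
    gcongr
    rw [hw]
    gcongr
    refine momentum_gap_le.trans (le_of_eq ?_)
    rw [he0, he1, abs_sub_comm (u 0 t), abs_sub_comm (u 1 t), add_comm]
    simp
  have k1 := hb.rate_le 1 _ (abs_sub_le_of_mem_Icc (hu 0) (hu 1)) _ hθ
  have k1' := hb.rate_nonneg 1 (u 0 t - u 1 t) _ hθ
  have k0 := hb.rate_le 0 _ (abs_sub_le_of_mem_Icc (hu 1) (hu 0)) _ hθ
  have k0' := hb.rate_nonneg 0 (u 1 t - u 0 t) _ hθ
  set a1 := optimalRate c (u 0 t - u 1 t) (θ t) 1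
  set a0 := optimalRate c (u 1 t - u 0 t) (θ t) 0
  set G := gammaPlus N β I n t
  set F := gammaMinus β I n t
  set b1 := β 1 n t
  set b0 := β 0 n t
  have hw0 : 0 ≤ w := by positivity
  have hyw : |y| ≤ w := by rw [hw]; linarith [abs_nonneg e0, abs_nonneg e1]
  have hF : F * ((((n - 1 : ℕ) : ℝ) / N - θ t) ^ 2 - y ^ 2) = F * (-2 * y / N + 1 / N ^ 2) := by
    cases n with
    | zero =>
      have : F = 0 := by simp [F, gammaMinus]
      rw [this, zero_mul, zero_mul]
    | succ m =>
      rw [add_tsub_cancel_right, hy]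
      push_cast
      field_simp
      ring
  have hG : G * ((((n + 1 : ℕ) : ℝ) / N - θ t) ^ 2 - y ^ 2) = G * (2 * y / N + 1 / N ^ 2) := by
    rw [hy]
    push_cast
    field_simp
    ring
  -- `R` is the difference of the drifts, split into the change of reference state, the change of
  -- controls, and the replacement of `n/N` by `θ`.
  set R := (G - (N - n) * b1) / N - (F - n * b0) / N + (1 - (n : ℝ) / N) * (b1 - a1)
    - (n : ℝ) / N * (b0 - a0) - y * a1 - y * a0 with hR
  have hexp : 2 * y * (0 - ((1 - θ t) * a1 - θ t * a0)) + (G * (2 * y / N + 1 / N ^ 2)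
      + F * (-2 * y / N + 1 / N ^ 2)) = 2 * (y * R) + (G + F) / N ^ 2 := by
    rw [hR, hy]
    field_simp
    ring
  rw [hG, hF, hexp]
  have t1 : |(G - (N - n) * b1) / N| ≤ d / N := by
    rw [abs_div, abs_of_pos hN0]
    gcongr
  have t2 : |(F - n * b0) / N| ≤ d / N := by
    rw [abs_div, abs_of_pos hN0]
    gcongr
  have t3 : |(1 - (n : ℝ) / N) * (b1 - a1)| ≤ K * w := by
    rw [abs_mul, abs_of_nonneg (by linarith [hν.2])]
    calc _ ≤ 1 * (K * w) := mul_le_mul (by linarith [hν.1]) r1 (abs_nonneg _) zero_le_one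
      _ = _ := one_mul _
  have t4 : |(n : ℝ) / N * (b0 - a0)| ≤ K * w := by
    rw [abs_mul, abs_of_nonneg hν.1]
    calc _ ≤ 1 * (K * w) := mul_le_mul hν.2 r0 (abs_nonneg _) zero_le_one
      _ = _ := one_mul _
  have t5 : |y * a1| ≤ K * w := by
    rw [abs_mul, abs_of_nonneg k1', mul_comm]
    exact mul_le_mul k1 hyw (abs_nonneg _) (by linarith)
  have t6 : |y * a0| ≤ K * w := by
    rw [abs_mul, abs_of_nonneg k0', mul_comm]
    exact mul_le_mul k0 hyw (abs_nonneg _) (by linarith)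
  have hRle : |R| ≤ 2 * (d / N) + 4 * (K * w) := by
    rw [abs_le] at *
    constructor <;> linarith [t1.1, t1.2, t2.1, t2.2, t3.1, t3.2, t4.1, t4.2, t5.1, t5.2,
      t6.1, t6.2]
  have hyR : |y * R| ≤ 2 * (d / N) + 4 * (K * (3 * (y ^ 2 + e0 ^ 2 + e1 ^ 2))) := by
    rw [abs_mul]
    calc |y| * |R| ≤ |y| * (2 * (d / N) + 4 * (K * w)) := by gcongr
      _ = |y| * (2 * (d / N)) + 4 * (K * (|y| * w)) := by ring
      _ ≤ 1 * (2 * (d / N)) + 4 * (K * (3 * (y ^ 2 + e0 ^ 2 + e1 ^ 2))) :=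
        add_le_add (mul_le_mul_of_nonneg_right hy1 (by positivity)) (mul_le_mul_of_nonneg_left
          (mul_le_mul_of_nonneg_left (abs_mul_sum_le y e0 e1) (by linarith)) (by norm_num))
      _ = _ := by ring
  have hGF : |(G + F) / N ^ 2| ≤ 2 * K * (1 / N) := by
    rw [abs_of_nonneg (div_nonneg (add_nonneg gp.1 gm.1) (by positivity)), div_le_iff₀
      (by positivity)]
    have : 2 * K * (1 / N) * N ^ 2 = N * K + N * K := by field_simp; ring
    rw [this]
    exact add_le_add gp.2 gm.2
  have hfin := (abs_add_le (2 * (y * R)) ((G + F) / N ^ 2)).trans (add_le_add le_rfl hGF)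
  rw [abs_mul, abs_two] at hfin
  refine hfin.trans ?_
  have hgap : gap N u θ uN n t = y ^ 2 + e0 ^ 2 + e1 ^ 2 := rfl
  rw [hgap, growthConst, ← hd]
  set s := y ^ 2 + e0 ^ 2 + e1 ^ 2 with hs
  have hs0 : 0 ≤ s := by positivity
  set v := 1 / (N : ℝ) with hv
  have hv0 : 0 ≤ v := by positivity
  have hdv : d / N = d * v := by rw [hv]; ring
  rw [hdv] at hyR
  have m1 : 0 ≤ d * s := by positivity
  have m2 : 0 ≤ K * s := by positivity
  have m3 : 0 ≤ P * d * (K + 2) * s := by positivity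
  have m4 : 0 ≤ K * (K + 2) ^ 2 * s := by positivity
  have m5 : 0 ≤ K * v := by positivity
  have m6 : 0 ≤ P * d * (K + 2) * v := by positivity
  have m7 : 0 ≤ K * (K + 2) ^ 2 * v := by positivity
  linarith

/-- The generator applied to the square deviation of the value functions. -/
theorem abs_generator_value_le (hb : DataBounds c ψ P K) (hN : 1 ≤ N) {t : ℝ}
    (hθ : θ t ∈ Icc (0 : ℝ) 1) (hu : ∀ i, u i t ∈ Icc 0 P)
    (huN : ∀ i, ∀ n ≤ N, uN i n t ∈ Icc 0 P)
    (hgrad : ∀ i n, n + 1 ≤ N → |uN i (n + 1) t - uN i n t| ≤ (K + 2) / N)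
    (i I : Fin 2) {n : ℕ} (hn : n ≤ N) :
    |2 * (u i t - uN i n t) * (-hamiltonian c (u (1 - i) t - u i t) (θ t) i
        - -(gammaPlus N (feedbackControl c N uN) i n t * (uN i (n + 1) t - uN i n t)
          + gammaMinus (feedbackControl c N uN) i n t * (uN i (n - 1) t - uN i n t)
          + hamiltonian c (uN (1 - i) n t - uN i n t) ((n : ℝ) / N) i))
      + (gammaPlus N (feedbackControl c N uN) I n t *
          ((u i t - uN i (n + 1) t) ^ 2 - (u i t - uN i n t) ^ 2)
        + gammaMinus (feedbackControl c N uN) I n t *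
          ((u i t - uN i (n - 1) t) ^ 2 - (u i t - uN i n t) ^ 2))|
      ≤ growthConst P K * (gap N u θ uN n t + 1 / N) := by
  have hK := hb.one_le
  have hP := hb.bound_nonneg
  have hN0 : (0 : ℝ) < N := by exact_mod_cast hN
  have hβ := feedbackControl_mem hb huN
  have hD := feedbackControl_succ_sub_le hb hgrad
  set β := feedbackControl c N uN with hβd
  set d := K * (2 * (K + 2) + 1) with hd
  have hD' : K * (2 * ((K + 2) / N) + 1 / N) = d / N := by rw [hd]; field_simp
  rw [hD'] at hD
  have hD0 : 0 ≤ d / N := by positivity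
  have hNd : N * (d / N) = d := by field_simp
  have gp := gammaPlus_mem hβ I hn
  have gm := gammaMinus_mem hβ I hn
  have dp := abs_gammaPlus_sub_le hD0 hD i I hn
  have dm := abs_gammaMinus_sub_le hD0 hD i I hn
  rw [hNd] at dp dm
  have hν := natCast_div_mem_unit hn
  set y := (n : ℝ) / N - θ t with hy
  set e := u i t - uN i n t with he
  set e' := u (1 - i) t - uN (1 - i) n t with he'
  have hgap : gap N u θ uN n t = e ^ 2 + e' ^ 2 + y ^ 2 := by
    unfold gap
    fin_cases i
    · simp [he, he', hy]; ring
    · simp [he, he', hy]; ring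
  have hePle : |e| ≤ P := abs_sub_le_of_mem_Icc (hu i) (huN i n hn)
  set δp := uN i (n + 1) t - uN i n t with hδp
  set δm := uN i (n - 1) t - uN i n t with hδm
  set L := K + 2 with hL
  have bp : n + 1 ≤ N → |δp| ≤ L / N := fun h => hgrad i n h
  have bm : 1 ≤ n → |δm| ≤ L / N := by
    intro h
    obtain ⟨m, rfl⟩ : ∃ m, n = m + 1 := ⟨n - 1, by omega⟩
    rw [hδm, abs_sub_comm]
    exact hgrad i m hn
  have hh := hb.ham_lip i _ _ (abs_sub_le_of_mem_Icc (huN (1 - i) n hn) (huN i n hn))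
    (abs_sub_le_of_mem_Icc (hu (1 - i)) (hu i)) _ hν _ hθ
  have hmom := momentum_gap_le (a := uN (1 - i) n t) (b := uN i n t) (a' := u (1 - i) t)
    (b' := u i t)
  rw [abs_sub_comm (uN (1 - i) n t) (u (1 - i) t), abs_sub_comm (uN i n t) (u i t), ← he,
    ← he'] at hmom
  set h₁ := hamiltonian c (uN (1 - i) n t - uN i n t) ((n : ℝ) / N) i
  set h₀ := hamiltonian c (u (1 - i) t - u i t) (θ t) i
  have hh' : |h₁ - h₀| ≤ K * (|e'| + |y| + |e|) := by
    refine hh.trans (mul_le_mul_of_nonneg_left ?_ (by linarith))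
    rw [← hy]
    linarith
  have q1 : |(gammaPlus N β i n t - gammaPlus N β I n t) * δp| ≤ d * (L / N) := by
    rcases hn.eq_or_lt with h | h
    · simp only [gammaPlus, h, sub_self, zero_mul, abs_zero]; positivity
    · rw [abs_mul]
      exact mul_le_mul dp (bp h) (abs_nonneg _) (by positivity)
  have q2 : |(gammaMinus β i n t - gammaMinus β I n t) * δm| ≤ d * (L / N) := by
    rcases Nat.eq_zero_or_pos n with h | h
    · simp only [gammaMinus, h, Nat.cast_zero, sub_self, zero_mul, abs_zero]; positivity
    · rw [abs_mul]
      exact mul_le_mul dm (bm h) (abs_nonneg _) (by positivity)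
  have sq_le : ∀ x : ℝ, |x| ≤ L / N → |x ^ 2| ≤ (L / N) ^ 2 := fun x hx => by
    rw [abs_pow]; gcongr
  have q3 : |gammaPlus N β I n t * δp ^ 2| ≤ N * K * (L / N) ^ 2 := by
    rcases hn.eq_or_lt with h | h
    · simp only [gammaPlus, h, sub_self, zero_mul, abs_zero]; positivity
    · rw [abs_mul, abs_of_nonneg gp.1]
      exact mul_le_mul gp.2 (sq_le _ (bp h)) (abs_nonneg _) (by positivity)
  have q4 : |gammaMinus β I n t * δm ^ 2| ≤ N * K * (L / N) ^ 2 := by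
    rcases Nat.eq_zero_or_pos n with h | h
    · simp only [gammaMinus, h, Nat.cast_zero, zero_mul, abs_zero]; positivity
    · rw [abs_mul, abs_of_nonneg gm.1]
      exact mul_le_mul gm.2 (sq_le _ (bm h)) (abs_nonneg _) (by positivity)
  have s1 : u i t - uN i (n + 1) t = e - δp := by rw [he, hδp]; ring
  have s2 : u i t - uN i (n - 1) t = e - δm := by rw [he, hδm]; ring
  rw [s1, s2]
  set Gi := gammaPlus N β i n t
  set GI := gammaPlus N β I n t
  set Fi := gammaMinus β i n t
  set FI := gammaMinus β I n t
  -- The equation of `u_n(i)` uses the rates for `i`, the process those for its current state `I`.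
  -- The mismatch is `O(1)` times a jump of size `O(1/N)`; the squares give `N · O(1/N²)`.
  have hexp : 2 * e * (-h₀ - -(Gi * δp + Fi * δm + h₁)) + (GI * ((e - δp) ^ 2 - e ^ 2)
      + FI * ((e - δm) ^ 2 - e ^ 2)) = 2 * (e * (h₁ - h₀))
        + 2 * (e * ((Gi - GI) * δp + (Fi - FI) * δm)) + (GI * δp ^ 2 + FI * δm ^ 2) := by
    ring
  rw [hexp]
  have f1 : |e * (h₁ - h₀)| ≤ K * (3 * (e ^ 2 + e' ^ 2 + y ^ 2)) := by
    rw [abs_mul]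
    calc |e| * |h₁ - h₀| ≤ |e| * (K * (|e'| + |y| + |e|)) := by gcongr
      _ = K * (|e| * (|e'| + |y| + |e|)) := by ring
      _ ≤ _ := mul_le_mul_of_nonneg_left (abs_mul_sum_le e e' y) (by linarith)
  have f2 : |e * ((Gi - GI) * δp + (Fi - FI) * δm)| ≤ P * (d * (L / N) + d * (L / N)) := by
    rw [abs_mul]
    exact mul_le_mul hePle ((abs_add_le _ _).trans (add_le_add q1 q2)) (abs_nonneg _) hP
  have f3 : N * K * (L / N) ^ 2 = K * L ^ 2 * (1 / N) := by field_simp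
  rw [f3] at q3 q4
  rw [hgap, growthConst, ← hL, ← hd]
  set s := e ^ 2 + e' ^ 2 + y ^ 2 with hs
  have hs0 : 0 ≤ s := by positivity
  set v := 1 / (N : ℝ) with hv
  have hv0 : 0 ≤ v := by positivity
  have hLv : L / N = L * v := by rw [hv]; ring
  rw [hLv] at f2
  have m1 : 0 ≤ d * s := by positivity
  have m2 : 0 ≤ K * s := by positivity
  have m3 : 0 ≤ P * d * L * s := by positivity
  have m4 : 0 ≤ K * L ^ 2 * s := by positivity
  have m5 : 0 ≤ K * v := by positivity
  have m6 : 0 ≤ d * v := by positivity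
  rw [abs_le] at *
  constructor <;> linarith [f1.1, f1.2, f2.1, f2.2, q3.1, q3.2, q4.1, q4.2]

end Convergence

/-! ### Closing the forward and backward estimates -/

section Convergence

variable {c : Fin 2 → ℝ → ℝ → ℝ} {ψ : Fin 2 → ℝ → ℝ} {P K T θbar : ℝ} {N : ℕ}
  {u : Fin 2 → ℝ → ℝ} {θ : ℝ → ℝ} {uN : Fin 2 → ℕ → ℝ → ℝ}
  {Ω : Type*} [MeasurableSpace Ω] {μ : Measure Ω}
  {X : ℝ → Ω → Fin 2 × Fin (N + 1)}

theorem VN_nonneg (t : ℝ) : 0 ≤ VN μ N X θ t := integral_nonneg fun _ => sq_nonneg _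

theorem QN_nonneg (t : ℝ) : 0 ≤ QN μ N X u uN t :=
  add_nonneg (integral_nonneg fun _ => sq_nonneg _) (integral_nonneg fun _ => sq_nonneg _)

variable [IsProbabilityMeasure μ]

theorem VN_eq_sum {t : ℝ} (hX : Measurable (X t)) :
    VN μ N X θ t = ∑ x, law μ X x t * ((x.2 : ℕ) / (N : ℝ) - θ t) ^ 2 :=
  integral_comp_eq_sum_law hX fun x => ((x.2 : ℕ) / (N : ℝ) - θ t) ^ 2

theorem WN_eq_sum {t : ℝ} (hX : Measurable (X t)) (i : Fin 2) :
    WN μ N X u uN i t = ∑ x, law μ X x t * (u i t - uN i (x.2 : ℕ) t) ^ 2 :=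
  integral_comp_eq_sum_law hX fun x => (u i t - uN i (x.2 : ℕ) t) ^ 2

theorem sum_law_mul_gap {t : ℝ} (hX : Measurable (X t)) :
    ∑ x, law μ X x t * gap N u θ uN x.2 t = VN μ N X θ t + QN μ N X u uN t := by
  rw [QN, VN_eq_sum hX, WN_eq_sum hX, WN_eq_sum hX, ← Finset.sum_add_distrib,
    ← Finset.sum_add_distrib]
  refine Finset.sum_congr rfl fun x _ => ?_
  rw [gap]
  ring

/-- The terminal value of `Q_N` is controlled by that of `V_N`. -/
theorem WN_terminal_le (hb : DataBounds c ψ P K) (hT : 0 ≤ T)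
    (hmf : IsMeanFieldSolution c ψ T θbar u θ) (hnp : IsNPlayerSolution c ψ T N uN)
    (hX : Measurable (X T)) (i : Fin 2) :
    WN μ N X u uN i T ≤ K ^ 2 * VN μ N X θ T := by
  rw [WN_eq_sum hX, VN_eq_sum hX, Finset.mul_sum]
  refine Finset.sum_le_sum fun x _ => ?_
  have hx : (x.2 : ℕ) ≤ N := by omega
  have h := hb.psi_lip i _ (hmf.mem T ⟨hT, le_rfl⟩) _ (natCast_div_mem_unit hx)
  rw [hmf.terminal, hnp.terminal i _ hx]
  have h2 : (ψ i (θ T) - ψ i ((x.2 : ℕ) / (N : ℝ))) ^ 2 ≤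
      K ^ 2 * ((x.2 : ℕ) / (N : ℝ) - θ T) ^ 2 := by
    rw [← sq_abs, ← sq_abs ((x.2 : ℕ) / (N : ℝ) - θ T), ← mul_pow,
      abs_sub_comm ((x.2 : ℕ) / (N : ℝ))]
    gcongr
  calc _ ≤ law μ X x T * (K ^ 2 * ((x.2 : ℕ) / (N : ℝ) - θ T) ^ 2) :=
        mul_le_mul_of_nonneg_left h2 (law_nonneg x T)
    _ = _ := by ring

/-- Convergence at rate `1 / N` for small times. -/
theorem VN_add_QN_le (hb : DataBounds c ψ P K) (hN : 1 ≤ N) (hT0 : 0 ≤ T) (hT1 : T ≤ 1)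
    (hTs : T * barrierSlope K ≤ 1) (hTg : T * (growthConst P K * (3 + 2 * K ^ 2)) ≤ 1 / 2)
    (hθbar : θbar ∈ Icc (0 : ℝ) 1) (hmf : IsMeanFieldSolution c ψ T θbar u θ)
    (hnp : IsNPlayerSolution c ψ T N uN) (hX : IsGameProcess μ T N (feedbackControl c N uN) X)
    (hbin : IsBinomial μ N θbar fun ω => (X 0 ω).2) :
    ∀ t ∈ Icc 0 T, VN μ N X θ t + QN μ N X u uN t ≤ (3 + 4 * K ^ 2) / N := by
  have hK := hb.one_le
  have hP := hb.bound_nonneg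
  have hN0 : (0 : ℝ) < N := by exact_mod_cast hN
  have hbd := nPlayer_bounds hb hT1 hnp
  have hut : ∀ t ∈ Icc 0 T, ∀ i, ∀ n ≤ N, uN i n t ∈ Icc 0 P :=
    fun t ht i n hn => hbd i n hn t ht
  have hmfb := meanField_bounds hb hT0 hT1 hmf
  have hgrad := nPlayer_gradient hb hT1 hTs hN hnp
  have hβ := fun t (ht : t ∈ Icc 0 T) => feedbackControl_mem hb (hut t ht)
  have hle : ∀ x : Fin 2 × Fin (N + 1), (x.2 : ℕ) ≤ N := fun x => by omega
  set a := growthConst P K with ha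
  have ha0 : 0 ≤ a := by rw [ha, growthConst]; positivity
  have hdV : ∀ n ≤ N, ∀ t ∈ Icc 0 T, HasDerivWithinAt (fun t => ((n : ℝ) / N - θ t) ^ 2)
      (2 * ((n : ℝ) / N - θ t) * (0 - ((1 - θ t) * optimalRate c (u 0 t - u 1 t) (θ t) 1
        - θ t * optimalRate c (u 1 t - u 0 t) (θ t) 0))) (Icc 0 T) t := fun n _ t ht =>
    (((hmf.kolmogorov t ht).const_sub ((n : ℝ) / N)).fun_pow 2).congr_deriv (by
      push_cast; ring)
  have hdW : ∀ i, ∀ n ≤ N, ∀ t ∈ Icc 0 T, HasDerivWithinAt (fun t => (u i t - uN i n t) ^ 2)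
      (2 * (u i t - uN i n t) * (-hamiltonian c (u (1 - i) t - u i t) (θ t) i
        - -(gammaPlus N (feedbackControl c N uN) i n t * (uN i (n + 1) t - uN i n t)
          + gammaMinus (feedbackControl c N uN) i n t * (uN i (n - 1) t - uN i n t)
          + hamiltonian c (uN (1 - i) n t - uN i n t) ((n : ℝ) / N) i))) (Icc 0 T) t :=
    fun i n hn t ht => (((hmf.hj i t ht).sub (hnp.hj i n hn t ht)).fun_pow 2).congr_deriv (by
      push_cast; rw [Pi.sub_apply]; ring)
  have hΦcont : ContinuousOn (fun t => ∑ x, law μ X x t * gap N u θ uN x.2 t) (Icc 0 T) :=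
    continuousOn_finsetSum _ fun x _ => (hX.law_continuousOn hN hβ x).mul fun t ht =>
      (((hdV _ (hle x) t ht).add (hdW 0 _ (hle x) t ht)).add
        (hdW 1 _ (hle x) t ht)).continuousWithinAt
  obtain ⟨t₁, ht₁, hmax⟩ := isCompact_Icc.exists_isMaxOn (nonempty_Icc.2 hT0) hΦcont
  set M := VN μ N X θ t₁ + QN μ N X u uN t₁ with hM
  have hΦM : ∀ t ∈ Icc 0 T, ∑ x, law μ X x t * gap N u θ uN x.2 t ≤ M := by
    intro t ht
    rw [hM, ← sum_law_mul_gap (hX.measurable t₁ ht₁)]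
    exact hmax ht
  have hk : ∀ t ∈ Icc 0 T,
      ∑ x, law μ X x t * (a * (gap N u θ uN x.2 t + 1 / N)) ≤ a * (M + 1 / N) := by
    intro t ht
    have h1 : ∑ x, law μ X x t * (a * (gap N u θ uN x.2 t + 1 / N)) =
        a * (∑ x, law μ X x t * gap N u θ uN x.2 t + (∑ x, law μ X x t) * (1 / N)) := by
      rw [Finset.sum_mul, ← Finset.sum_add_distrib, Finset.mul_sum]
      exact Finset.sum_congr rfl fun x _ => by ring
    rw [h1, sum_law (hX.measurable t ht), one_mul]
    have := hΦM t ht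
    gcongr
  have hV : ∀ t ∈ Icc 0 T, VN μ N X θ t ≤ 1 / N + a * (M + 1 / N) * t := by
    intro t ht
    have h := hX.abs_expectation_sub_le hN hβ hdV
      (k := fun x t => a * (gap N u θ uN x.2 t + 1 / N))
      (fun t ht x => abs_generator_state_le hb hN (hmf.mem t ht) (fun i => hmfb i t ht)
        (hut t ht) (hgrad t ht) x.1 (hle x)) hk le_rfl ht.1 ht.2
    have h0 : (0 : ℝ) ∈ Icc 0 T := ⟨le_rfl, hT0⟩
    rw [← VN_eq_sum (hX.measurable t ht), ← VN_eq_sum (hX.measurable 0 h0), sub_zero] at h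
    have hzero_le : VN μ N X θ 0 ≤ 1 / N := by
      rw [VN, hmf.initial]
      exact sum_binomial_le hθbar hN (measurable_snd.comp (hX.measurable 0 h0)) hbin
    linarith [(abs_le.1 h).2]
  have hTT : T ∈ Icc 0 T := ⟨hT0, le_rfl⟩
  have hW : ∀ i, ∀ t ∈ Icc 0 T,
      WN μ N X u uN i t ≤ K ^ 2 * VN μ N X θ T + a * (M + 1 / N) * (T - t) := by
    intro i t ht
    have h := hX.abs_expectation_sub_le hN hβ (hdW i)
      (k := fun x t => a * (gap N u θ uN x.2 t + 1 / N))
      (fun t ht x => abs_generator_value_le hb hN (hmf.mem t ht) (fun i => hmfb i t ht)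
        (hut t ht) (hgrad t ht) i x.1 (hle x)) hk ht.1 ht.2 le_rfl
    rw [← WN_eq_sum (hX.measurable t ht), ← WN_eq_sum (hX.measurable T hTT)] at h
    have := WN_terminal_le hb hT0 hmf hnp (hX.measurable T hTT) (μ := μ) i
    linarith [(abs_le.1 h).1]
  have hv0 : 0 ≤ 1 / (N : ℝ) := by positivity
  have hM0 : 0 ≤ M := add_nonneg (VN_nonneg _) (QN_nonneg _)
  have hb0 : 0 ≤ a * (M + 1 / N) := by positivity
  set b := a * (M + 1 / N) * T with hbT
  have hbt : ∀ t ∈ Icc 0 T, a * (M + 1 / N) * t ≤ b := fun t ht =>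
    mul_le_mul_of_nonneg_left ht.2 hb0
  have hbt' : ∀ t ∈ Icc 0 T, a * (M + 1 / N) * (T - t) ≤ b := fun t ht =>
    mul_le_mul_of_nonneg_left (by linarith [ht.1]) hb0
  -- `VN` contributes one `b`, and each of the two `WN` contributes one `b` plus `K²` times the
  -- bound `1/N + b` on `VN` at `T`.
  have hall : ∀ t ∈ Icc 0 T, VN μ N X θ t + QN μ N X u uN t ≤
      (1 + 2 * K ^ 2) * (1 / N) + (3 + 2 * K ^ 2) * b := by
    intro t ht
    have h1 := hV t ht
    have h2 := mul_le_mul_of_nonneg_left ((hV T hTT).trans (by linarith [hbt T hTT] :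
      _ ≤ 1 / (N : ℝ) + b)) (sq_nonneg K)
    have h3 := hW 0 t ht
    have h4 := hW 1 t ht
    rw [QN]
    linarith [hbt t ht, hbt' t ht]
  have hsmall : (3 + 2 * K ^ 2) * b ≤ 1 / 2 * (M + 1 / N) := by
    calc (3 + 2 * K ^ 2) * b = T * (a * (3 + 2 * K ^ 2)) * (M + 1 / N) := by rw [hbT]; ring
      _ ≤ 1 / 2 * (M + 1 / N) := mul_le_mul_of_nonneg_right hTg (by positivity)
  -- At the maximum, `M ≤ (1 + 2K²)/N + (M + 1/N)/2`, and half of `M` is absorbed.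
  have hMle := hall t₁ ht₁
  intro t ht
  rw [div_eq_mul_one_div]
  have h5 := hΦM t ht
  rw [sum_law_mul_gap (hX.measurable t ht)] at h5
  linarith

end Convergence

end TwoStateGame

/-- One constant `D` serves for both `C₁` and `C₂`: for `T D < 1` one has `V_N + Q_N ≤ D / N`, which
implies all three estimates since the integrands are nonnegative. -/
theorem mainTheorem1 (c : Fin 2 → ℝ → ℝ → ℝ) (ψ : Fin 2 → ℝ → ℝ)
    (hcost : TwoStateGame.CostAssumptions c ψ) :
    ∃ C₁ > (0 : ℝ), ∃ C₂ > (0 : ℝ), ∀ C ρ T : ℝ, C = max C₁ C₂ → 0 < T → ρ = T * C → ρ < 1 →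
      ∀ θbar ∈ Set.Icc (0 : ℝ) 1,
      ∀ (u : Fin 2 → ℝ → ℝ) (θ : ℝ → ℝ), TwoStateGame.IsMeanFieldSolution c ψ T θbar u θ →
      ∀ N : ℕ, 1 ≤ N →
      ∀ uN : Fin 2 → ℕ → ℝ → ℝ, TwoStateGame.IsNPlayerSolution c ψ T N uN →
      ∀ (Ω : Type*) [MeasurableSpace Ω] (μ : MeasureTheory.Measure Ω)
        [MeasureTheory.IsProbabilityMeasure μ] (X : ℝ → Ω → Fin 2 × Fin (N + 1)),
      TwoStateGame.IsGameProcess μ T N (TwoStateGame.feedbackControl c N uN) X →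
      TwoStateGame.IsBinomial μ N θbar (fun ω => (X 0 ω).2) →
      ∀ t ∈ Set.Icc (0 : ℝ) T,
        TwoStateGame.VN μ N X θ t ≤
            (∫ s in (0 : ℝ)..t,
              C₁ * (TwoStateGame.VN μ N X θ s + TwoStateGame.QN μ N X u uN s)) + C₁ / N ∧
        TwoStateGame.QN μ N X u uN t ≤
            (∫ s in t..T,
              C₂ * (TwoStateGame.VN μ N X θ s + TwoStateGame.QN μ N X u uN s)) + C₂ / N ∧
        TwoStateGame.QN μ N X u uN t + TwoStateGame.VN μ N X θ t ≤ C / (1 - ρ) * (1 / N) := by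
  obtain ⟨P, K, hb⟩ := TwoStateGame.exists_dataBounds hcost
  have hK := hb.one_le
  have hP := hb.bound_nonneg
  have hB0 : 0 ≤ TwoStateGame.barrierSlope K := by
    unfold TwoStateGame.barrierSlope; positivity
  have hg0 : 0 ≤ TwoStateGame.growthConst P K * (3 + 2 * K ^ 2) := by
    unfold TwoStateGame.growthConst; positivity
  set B := TwoStateGame.barrierSlope K with hB
  set g := TwoStateGame.growthConst P K * (3 + 2 * K ^ 2) with hg
  have hKK : 0 ≤ K ^ 2 := sq_nonneg K
  -- With `T * D < 1`, the three summands yield `T * B ≤ 1`, `T * g ≤ 1/2` and `T ≤ 1`; the last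
  -- also dominates the constant in `VN_add_QN_le`.
  set D := B + 2 * g + (3 + 4 * K ^ 2) with hD
  have hD0 : 0 < D := by positivity
  refine ⟨D, hD0, D, hD0, ?_⟩
  intro C ρ T hC hT hρ hρ1 θbar hθbar u θ hmf N hN uN hnp Ω _ μ _ X hX hbin t ht
  rw [max_self] at hC
  subst hC
  have hTB := mul_nonneg hT.le hB0
  have hTg := mul_nonneg hT.le hg0
  have hTK := mul_nonneg hT.le hKK
  have hsum : T * B + 2 * (T * g) + 3 * T + 4 * (T * K ^ 2) < 1 := by
    rw [hρ, hD] at hρ1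
    linarith
  have hmain := TwoStateGame.VN_add_QN_le hb hN hT.le (by linarith) (by linarith)
    (by linarith) hθbar hmf hnp hX hbin t ht
  have hV := TwoStateGame.VN_nonneg (μ := μ) (N := N) (X := X) (θ := θ)
  have hQ := TwoStateGame.QN_nonneg (μ := μ) (N := N) (X := X) (u := u) (uN := uN)
  have hle : (3 + 4 * K ^ 2) / N ≤ D / N := by
    gcongr
    linarith
  have hintegral : ∀ a b : ℝ, a ≤ b → 0 ≤ ∫ s in a..b,
      D * (TwoStateGame.VN μ N X θ s + TwoStateGame.QN μ N X u uN s) := fun a b hab =>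
    intervalIntegral.integral_nonneg hab fun s _ => mul_nonneg hD0.le (add_nonneg (hV s) (hQ s))
  refine ⟨?_, ?_, ?_⟩
  · linarith [hintegral 0 t ht.1, hQ t]
  · linarith [hintegral t T ht.2, hV t]
  · have hρ0 : 0 ≤ ρ := by rw [hρ]; positivity
    have h1 : D ≤ D / (1 - ρ) := by
      rw [le_div_iff₀ (by linarith)]
      exact mul_le_of_le_one_right hD0.le (by linarith)
    calc _ ≤ D / N := by linarith
      _ = D * (1 / N) := by ring
      _ ≤ D / (1 - ρ) * (1 / N) := by gcongr
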